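/- Let $D$ be a locally compact Hausdorff space with countable base, let $\partial$ be a cemetery point adjoined to $D$ (the point at infinity of the one-point compactification, isolated if $D$ is compact), and let $X(t)$, $t\ge 0$, be a Hunt process on $D$ with lifetime $\zeta=\inf\{t : X(t)=\partial\}\in[0,\infty]$: a normal, right-continuous, strong Markov and quasi-left-continuous process with values in $D\cup\{\partial\}$, absorbed at $\partial$, with laws $\mathbb P^x$ depending measurably on the starting point $x$. Let $p_t(x,A)=\mathbb P^x(X(t)\in A)$ for Borel $A\subseteq D$, and $P_tf(x)=\int_D f(y)\,p_t(x,dy)$. Let $m$ be a finite Borel measure on $D$ such that $X(t)$ is self-dual with respect to $m$, that is, the operators $P_t$ are self-adjoint on $L^2(m)$: $\int_D f\,P_tg\,dm=\int_D P_tf\,g\,dm$ for all $f,g\in L^2(m)$ and $t\ge 0$. Assume in addition that the one-dimensional distributions of $X(t)$ are absolutely continuous with respect to $m$, that is, $p_t(x,\cdot)\ll m$ for every $t>0$ and every $x\in D$. The two-particle Fleming–Viot system with initial configuration $(x,y)\in D\times D$ is defined as follows. Let $\tau_0=0$, and let $(X_1,Y_1)$ be a pair of independent copies of $X$ started at $x$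 and $y$, respectively. For $n\ge 1$, let $\sigma_n=\min\{\zeta^{X_n},\zeta^{Y_n}\}$, let $\tau_n=\tau_{n-1}+\sigma_n$ (the $n$-th branching time), and let $Z_n$ be the position of the surviving particle when the other one dies: $Z_n=X_n(\zeta^{Y_n})$ if $\zeta^{Y_n}<\zeta^{X_n}$, $Z_n=Y_n(\zeta^{X_n})$ if $\zeta^{X_n}<\zeta^{Y_n}$, and $Z_n=\partial$ if $\zeta^{X_n}=\zeta^{Y_n}$. Given the first $n$ pairs $(X_1,Y_1),\dots,(X_n,Y_n)$, the pair $(X_{n+1},Y_{n+1})$ consists of two independent copies of $X$, both started at $Z_n$; on the time interval $[\tau_n,\tau_{n+1})$ the two particles are at $X_{n+1}(t-\tau_n)$ and $Y_{n+1}(t-\tau_n)$. (From $Z_n=\partial$ on, all later $\sigma_k$ are zero; thus simultaneous death of both particles at a finite time counts as extinction.) The system becomes extinct if $\tau_\infty=\lim_{n\to\infty}\tau_n<\infty$. Then, for every initial configuration $(x,y)\in D\times D$ (not only for almost every one), the system never becomes extinct: $\tau_\infty=\infty$ with probability one. -/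

import Mathlib

open MeasureTheory ProbabilityTheory Filter Topology
open scoped NNReal ENNReal OnePoint

namespace FlemingViot

universe u v

section OnePointSpace

/-! ### The state space with the cemetery point added

For a locally compact, second countable Hausdorff space `E`, the space `E ∪ {∂}` is Mathlib's
one-point compactification `OnePoint E` (in which `∂ = ∞` is isolated if and only if `E` is
compact), with its Borel σ-algebra. -/

instance instMeasurableSpaceOnePoint (E : Type u) [TopologicalSpace E] :
    MeasurableSpace (OnePoint E) := borel (OnePoint E)

instance instBorelSpaceOnePoint (E : Type u) [TopologicalSpace E] :
    BorelSpace (OnePoint E) := ⟨rfl⟩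

variable (E : Type u) [TopologicalSpace E] [T2Space E] [LocallyCompactSpace E]
  [SecondCountableTopology E]

theorem secondCountable_onePoint : SecondCountableTopology (OnePoint E) := by
  let K : CompactExhaustion E := default
  have hb := TopologicalSpace.isBasis_countableBasis E
  let B : Set (Set (OnePoint E)) :=
    ((fun s : Set E => (OnePoint.some '' s : Set (OnePoint E))) ''
      TopologicalSpace.countableBasis E) ∪
      Set.range (fun n => ((OnePoint.some '' K n : Set (OnePoint E)))ᶜ)
  have hB : TopologicalSpace.IsTopologicalBasis B := by
    refine TopologicalSpace.isTopologicalBasis_of_isOpen_of_nhds ?_ ?_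
    · rintro s (⟨t, ht, rfl⟩ | ⟨n, rfl⟩)
      · exact OnePoint.isOpen_image_coe.2 (hb.isOpen ht)
      · exact OnePoint.isOpen_compl_image_coe.2 ⟨(K.isCompact n).isClosed, K.isCompact n⟩
    · intro a s ha hs
      induction a using OnePoint.rec with
      | infty =>
        obtain ⟨-, hc⟩ := (OnePoint.isOpen_iff_of_mem ha).1 hs
        obtain ⟨n, hn⟩ := K.exists_superset_of_isCompact hc
        refine ⟨_, Or.inr ⟨n, rfl⟩, by simp, ?_⟩
        intro z hz
        induction z using OnePoint.rec with
        | infty => exact ha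
        | coe z =>
          by_contra hzs
          exact hz ⟨z, hn hzs, rfl⟩
      | coe a =>
        have ho : IsOpen ((OnePoint.some : E → OnePoint E) ⁻¹' s) :=
          hs.preimage OnePoint.continuous_coe
        obtain ⟨t, ht, hat, hts⟩ := hb.exists_subset_of_mem_open (show a ∈ _ from ha) ho
        refine ⟨_, Or.inl ⟨t, ht, rfl⟩, ⟨a, hat, rfl⟩, ?_⟩
        rintro _ ⟨z, hz, rfl⟩
        exact hts hz
  exact hB.secondCountableTopology
    (((TopologicalSpace.countable_countableBasis E).image _).union (Set.countable_range _))

theorem metrizable_onePoint : TopologicalSpace.MetrizableSpace (OnePoint E) := by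
  have := secondCountable_onePoint E
  exact TopologicalSpace.metrizableSpace_of_t3_secondCountable _

end OnePointSpace

section Hunt

/-- The natural filtration `𝓕⁰ₜ = σ(Xₛ : s ≤ t)` of a process. -/
def natFiltration {Ω : Type v} [mΩ : MeasurableSpace Ω] {S : Type u} [mS : MeasurableSpace S]
    (X : ℝ≥0 → Ω → S) (hX : ∀ t, Measurable (X t)) : Filtration ℝ≥0 mΩ where
  seq t := ⨆ s : Set.Iic t, mS.comap (X s)
  mono' _ t hst := iSup_le fun s =>
    le_iSup (fun r : Set.Iic t => mS.comap (X r)) ⟨s.1, le_trans s.2 hst⟩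
  le' _ := iSup_le fun s => (hX s).comap_le

/-- A (Borel) Hunt process on the state space `E` (locally compact with countable base), with
cemetery `∂ = ∞ : OnePoint E`: a family of probability measures `P x` on a measurable space `Ω`
carrying a process `X` with values in `E ∪ {∂}` which is normal, right-continuous, absorbed at
`∂`, strong Markov, and quasi-left-continuous.

The last two properties refer to the right-continuous version `𝓕⁰ₜ₊` of the natural filtration.
Every stopping time of the usual augmented filtration is almost surely equal to an `𝓕⁰ₜ₊` stopping
time, so using the augmented filtration would define the same processes. Existence of left limits
on `(0, ∞)`, almost surely, is a consequence of the properties listed. -/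
structure HuntProcess (E : Type u) [TopologicalSpace E] (Ω : Type v) [MeasurableSpace Ω] where
  /-- the process -/
  X : ℝ≥0 → Ω → OnePoint E
  measurable_X : ∀ t, Measurable (X t)
  /-- the law `ℙˣ` of the process started at `x`; it depends measurably on `x` -/
  P : Kernel (OnePoint E) Ω
  isMarkovKernel : IsMarkovKernel P
  normal : ∀ x, ∀ᵐ ω ∂(P x), X 0 ω = x
  rightContinuous : ∀ ω t, ContinuousWithinAt (fun s => X s ω) (Set.Ici t) t
  absorbing : ∀ ω s t, s ≤ t → X s ω = OnePoint.infty → X t ω = OnePoint.infty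
  /-- strong Markov property: `ℙˣ(X(T + t) ∈ B | 𝓕_{T+}) = ℙ^{X(T)}(X(t) ∈ B)` on `{T < ∞}` -/
  strongMarkov : ∀ (T : Ω → WithTop ℝ≥0)
    (hT : IsStoppingTime (natFiltration X measurable_X).rightCont T)
    (x : OnePoint E) (A : Set Ω), MeasurableSet[hT.measurableSpace] A →
    ∀ (t : ℝ≥0) (B : Set (OnePoint E)), MeasurableSet B →
      P x (A ∩ {ω | T ω ≠ ⊤} ∩ {ω | X ((T ω).untopD 0 + t) ω ∈ B}) =
        ∫⁻ ω in A ∩ {ω | T ω ≠ ⊤}, P (X ((T ω).untopD 0) ω) {ω' | X t ω' ∈ B} ∂(P x)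
  /-- quasi-left-continuity: if `T n ↑ T`, then `X (T n) → X T` almost surely on `{T < ∞}` -/
  quasiLeftContinuous : ∀ (T : ℕ → Ω → WithTop ℝ≥0),
    (∀ n, IsStoppingTime (natFiltration X measurable_X).rightCont (T n)) → Monotone T →
    ∀ x : OnePoint E, ∀ᵐ ω ∂(P x), (⨆ n, T n ω) ≠ ⊤ →
      Tendsto (fun n => X ((T n ω).untopD 0) ω) atTop (𝓝 (X ((⨆ n, T n ω).untopD 0) ω))

namespace HuntProcess

variable {E : Type u} [TopologicalSpace E] {Ω : Type v} [MeasurableSpace Ω]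

instance instIsMarkovKernel (H : HuntProcess E Ω) : IsMarkovKernel H.P := H.isMarkovKernel

/-- The transition kernel on `E`: `p_t(x, A) = ℙˣ(X(t) ∈ A)` for Borel `A ⊆ E`. -/
noncomputable def transition [MeasurableSpace E] (H : HuntProcess E Ω) (t : ℝ≥0) (x : E) :
    Measure E :=
  ((H.P (x : OnePoint E)).map (H.X t)).comap ((↑) : E → OnePoint E)

/-- The transition operator `P_t f(x) = 𝔼ˣ f(X(t)) = ∫ f(y) p_t(x, dy)` (with `f(∂) = 0`). -/
noncomputable def transitionOp [MeasurableSpace E] (H : HuntProcess E Ω) (t : ℝ≥0) (f : E → ℝ)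
    (x : E) : ℝ :=
  ∫ y, f y ∂(H.transition t x)

/-- Self-duality (symmetry) with respect to `m`: the transition operators are self-adjoint on
`L²(m)`. -/
def IsSelfDual [MeasurableSpace E] (H : HuntProcess E Ω) (m : Measure E) : Prop :=
  ∀ (t : ℝ≥0) (f g : E → ℝ), Measurable f → Measurable g → MemLp f 2 m → MemLp g 2 m →
    ∫ x, f x * H.transitionOp t g x ∂m = ∫ x, H.transitionOp t f x * g x ∂m

/-- The lifetime `ζ = inf {t : X(t) = ∂}`. -/
noncomputable def lifetime (H : HuntProcess E Ω) (ω : Ω) : ℝ≥0∞ :=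
  ⨅ (t : ℝ≥0) (_ : H.X t ω = OnePoint.infty), (t : ℝ≥0∞)

/-- The first time `σ = min {ζ^X, ζ^Y}` at which one of two particles dies; a point `p : Ω × Ω`
encodes the pair of paths `X = H.X · p.1` and `Y = H.X · p.2`. -/
noncomputable def firstDeath (H : HuntProcess E Ω) (p : Ω × Ω) : ℝ≥0∞ :=
  min (H.lifetime p.1) (H.lifetime p.2)

open Classical in
/-- The position `Z` of the surviving particle at the time when the other one dies:
`X(ζ^Y)` if `ζ^Y < ζ^X`, `Y(ζ^X)` if `ζ^X < ζ^Y`, and `∂` if `ζ^X = ζ^Y`. -/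
noncomputable def survivor (H : HuntProcess E Ω) (p : Ω × Ω) : OnePoint E :=
  if H.lifetime p.2 < H.lifetime p.1 then H.X (H.lifetime p.2).toNNReal p.1
  else if H.lifetime p.1 < H.lifetime p.2 then H.X (H.lifetime p.1).toNNReal p.2
  else OnePoint.infty

/-- The branching times: `τ_0 = 0` and `τ_n = τ_{n-1} + σ_n`. -/
noncomputable def branchingTime (H : HuntProcess E Ω) (n : ℕ) (w : ℕ → Ω × Ω) : ℝ≥0∞ :=
  ∑ k ∈ Finset.range n, H.firstDeath (w k)

/-- The extinction time `τ_∞ = lim τ_n` of the Fleming–Viot system (the limit of a nondecreasing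
sequence). -/
noncomputable def extinctionTime (H : HuntProcess E Ω) (w : ℕ → Ω × Ω) : ℝ≥0∞ :=
  ⨆ n, H.branchingTime n w

/-- The system becomes extinct if `τ_∞ < ∞`. -/
def Extinct (H : HuntProcess E Ω) (w : ℕ → Ω × Ω) : Prop :=
  H.extinctionTime w < ⊤

theorem lifetime_le_iff [T1Space (OnePoint E)] (H : HuntProcess E Ω) (ω : Ω) (t : ℝ≥0) :
    H.lifetime ω ≤ t ↔ H.X t ω = OnePoint.infty := by
  constructor
  · intro h
    by_contra hne
    have hopen : IsOpen ({OnePoint.infty}ᶜ : Set (OnePoint E)) := isOpen_compl_singleton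
    have h1 : ∀ᶠ s in 𝓝[Set.Ici t] t, H.X s ω ∈ ({OnePoint.infty}ᶜ : Set (OnePoint E)) :=
      (H.rightContinuous ω t).eventually (hopen.mem_nhds hne)
    have h2 : ∀ᶠ s in 𝓝[>] t, H.X s ω ∈ ({OnePoint.infty}ᶜ : Set (OnePoint E)) :=
      h1.filter_mono (nhdsWithin_mono _ Set.Ioi_subset_Ici_self)
    obtain ⟨s, hs, hts⟩ := (h2.and self_mem_nhdsWithin).exists
    have h3 : (s : ℝ≥0∞) ≤ H.lifetime ω := by
      refine le_iInf₂ fun r hr => ?_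
      by_contra hlt
      exact hs (H.absorbing ω r s (by exact_mod_cast (not_le.1 hlt).le) hr)
    exact absurd (lt_of_lt_of_le (by exact_mod_cast hts) (h3.trans h)) (lt_irrefl (t : ℝ≥0∞))
  · intro h
    exact iInf₂_le t h

theorem measurable_lifetime [T1Space (OnePoint E)] (H : HuntProcess E Ω) :
    Measurable H.lifetime := by
  refine measurable_of_Iic fun c => ?_
  induction c with
  | top => simp
  | coe t =>
    have : H.lifetime ⁻¹' Set.Iic (t : ℝ≥0∞) = H.X t ⁻¹' {OnePoint.infty} := by
      ext ω
      exact H.lifetime_le_iff ω t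
    rw [this]
    exact H.measurable_X t (measurableSet_singleton _)

theorem measurable_uncurry_X [TopologicalSpace.MetrizableSpace (OnePoint E)]
    (H : HuntProcess E Ω) : Measurable (fun q : ℝ≥0 × Ω => H.X q.1 q.2) := by
  obtain ⟨a, had⟩ : ∃ a : ℕ → ℝ≥0 → ℝ≥0, ∀ n r, a n r = ((⌊r * (n + 1)⌋₊ : ℝ≥0) + 1) / (n + 1) :=
    ⟨_, fun _ _ => rfl⟩
  have ha : ∀ n r, r ≤ a n r := fun n r => by
    rw [had, le_div_iff₀ (by positivity)]
    exact (Nat.lt_floor_add_one _).le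
  have ha' : ∀ n r, a n r ≤ r + 1 / (n + 1) := fun n r => by
    have hp : (0 : ℝ≥0) < n + 1 := by positivity
    rw [had, div_le_iff₀ hp, add_mul, one_div, inv_mul_cancel₀ hp.ne']
    gcongr
    exact Nat.floor_le zero_le
  have hlim : ∀ r, Tendsto (fun n => a n r) atTop (𝓝 r) := fun r => by
    refine tendsto_of_tendsto_of_tendsto_of_le_of_le tendsto_const_nhds ?_
      (fun n => ha n r) (fun n => ha' n r)
    simpa using (tendsto_const_nhds (x := r)).add
      (tendsto_one_div_add_atTop_nhds_zero_nat (𝕜 := ℝ≥0))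
  refine measurable_of_tendsto_metrizable
    (f := fun n (q : ℝ≥0 × Ω) => H.X (a n q.1) q.2) (fun n => ?_) ?_
  · simp only [had]
    generalize (n : ℝ≥0) + 1 = c
    obtain ⟨g, hg⟩ : ∃ g : ℕ × Ω → OnePoint E, ∀ q, g q = H.X (((q.1 : ℝ≥0) + 1) / c) q.2 :=
      ⟨_, fun _ => rfl⟩
    obtain ⟨k, hk⟩ : ∃ k : ℝ≥0 → ℕ, ∀ r, k r = ⌊r * c⌋₊ := ⟨_, fun _ => rfl⟩
    have h1 : Measurable g := measurable_from_prod_countable_right fun l => by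
      simp only [hg]
      exact H.measurable_X (((l : ℝ≥0) + 1) / c)
    have h2 : Measurable k := by
      rw [funext hk]
      exact Nat.measurable_floor.comp (measurable_id.mul_const c)
    have h3 := h1.comp ((h2.comp measurable_fst).prodMk measurable_snd : Measurable
      fun q : ℝ≥0 × Ω => (k q.1, q.2))
    simpa only [Function.comp_def, hg, hk] using h3
  · refine tendsto_pi_nhds.2 fun q => ?_
    have h3 : Tendsto (fun n => a n q.1) atTop (𝓝[Set.Ici q.1] q.1) :=
      tendsto_nhdsWithin_iff.2 ⟨hlim q.1, Eventually.of_forall fun n => ha n q.1⟩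
    have h4 : Tendsto (fun s => H.X s q.2) (𝓝[Set.Ici q.1] q.1) (𝓝 (H.X q.1 q.2)) :=
      H.rightContinuous q.2 q.1
    exact h4.comp h3

variable [T2Space E] [LocallyCompactSpace E] [SecondCountableTopology E]

theorem measurable_survivor (H : HuntProcess E Ω) : Measurable H.survivor := by
  have := metrizable_onePoint E
  have hL := H.measurable_lifetime
  have hX := H.measurable_uncurry_X
  have h1 : Measurable fun p : Ω × Ω => H.lifetime p.1 := hL.comp measurable_fst
  have h2 : Measurable fun p : Ω × Ω => H.lifetime p.2 := hL.comp measurable_snd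
  refine Measurable.ite (measurableSet_lt h2 h1) ?_
    (Measurable.ite (measurableSet_lt h1 h2) ?_ measurable_const)
  · exact hX.comp (h2.ennreal_toNNReal.prodMk measurable_fst)
  · exact hX.comp (h1.ennreal_toNNReal.prodMk measurable_snd)

/-- The law of the next pair of paths, given the present one: two independent copies of the
process, both started at the position of the surviving particle. -/
noncomputable def nextExcursion (H : HuntProcess E Ω) : Kernel (Ω × Ω) (Ω × Ω) :=
  (H.P ∥ₖ H.P).comap (fun p => (H.survivor p, H.survivor p))
    (H.measurable_survivor.prodMk H.measurable_survivor)

instance instIsMarkovKernelNextExcursion (H : HuntProcess E Ω) :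
    IsMarkovKernel H.nextExcursion := by
  unfold nextExcursion
  infer_instance

/-- The probability measure of the Fleming–Viot system of two particles with initial
configuration `(x, y)`, on the space of sequences of excursions. The `n`-th term of the sequence
(`n = 0, 1, …`) encodes the pair of paths which the two particles follow between the `n`-th and
the `(n + 1)`-st branching time. The first pair of paths is a pair of independent copies of the
process started at `x` and at `y`; given the first `n + 1` pairs, the next one is a pair of
independent copies of the process started at the position of the particle that survived the last
pair of paths. (If both particles die simultaneously at a finite time, then the next pair of paths
starts at `(∂, ∂)` and has duration zero, and so on, so that the system becomes extinct.) -/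
noncomputable def flemingViot (H : HuntProcess E Ω) (x y : E) : Measure (ℕ → Ω × Ω) :=
  Kernel.trajMeasure (X := fun _ => Ω × Ω)
    ((H.P (x : OnePoint E)).prod (H.P (y : OnePoint E)))
    (fun n => H.nextExcursion.comap
      (fun h : (i : Finset.Iic n) → Ω × Ω => h ⟨n, Finset.mem_Iic.2 le_rfl⟩)
      (measurable_pi_apply _))

end HuntProcess

end Hunt

end FlemingViot

namespace FlemingViot

universe u v

section SymmetricSemigroup

/-! ### Second differences along a symmetric semigroup -/

/-! The heart of the proof is that `m` is subinvariant for the chain of survivor positions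
(`survivorLaw_pairLaw_le`). Let two independent particles start at a common point distributed as
`m`, and cut time into cells of length `h`. By self-adjointness, the event that the first dies in
the cell `(kh, (k+1)h]`, with `G` evaluated at the second at time `(k+1)h`, has weight `a (2k+1) - a
(2k+2)`, where `a j = ⟨G, P_{jh} 1⟩`. Summing over `k` uses every other decrement of `a`. If
neighbouring decrements agreed, the sum would be half of a telescoping one, hence at most `∫ G dm /
2`; the case in which the other particle survives supplies the second half.

The discrepancy is a sum of second differences of `a`. By Cauchy–Schwarz with a weight `c` it is
controlled by the second differences of `⟨G, P_t G⟩` and `⟨1, P_t 1⟩`, which are nonnegative and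
telescope. The part with `1` vanishes as `h → 0`, the part with `G` stays bounded; so let `h → 0`
first (Fatou and right-continuity), then `c → 0`.

Simultaneous deaths are negligible: `⟨1, P_t 1⟩` is convex, so the lifetime has no positive atoms
under `m`, and `p_t(x, ·) ≪ m` carries this over to every starting point (`lifetime_ne`).

For the conclusion, the law of the first survivor is absolutely continuous with respect to `m`.
Truncating its density and iterating subinvariance bounds the probability that a later excursion
lasts at most `ε`, all excursions being finite, by `M ℙ^m(σ ≤ ε) + δ`, with `M` independent of `ε`
and of the excursion. Extinction forces all late excursions to be shorter than `ε`; let `ε → 0`,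
then `δ → 0`. -/

theorem sum_odd_secondDiff_le {a : ℕ → ℝ} (ha : ∀ j, 0 ≤ a j - 2 * a (j + 1) + a (j + 2)) (n : ℕ) :
    ∑ k ∈ Finset.range n, (a (2 * k + 1) - 2 * a (2 * k + 2) + a (2 * k + 3)) ≤
      a 1 - a 2 + (a (2 * n + 2) - a (2 * n + 1)) := by
  induction n with
  | zero => simp
  | succ n ih =>
    rw [Finset.sum_range_succ]
    have h := ha (2 * n + 2)
    have e1 : 2 * (n + 1) + 2 = 2 * n + 2 + 2 := by ring
    have e2 : 2 * (n + 1) + 1 = 2 * n + 2 + 1 := by ring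
    rw [e1, e2]
    linarith

/-- Each odd decrement, counted twice, is itself plus its successor plus a second difference; the
first two telescope. -/
theorem two_mul_sum_odd_diff (a : ℕ → ℝ) (n : ℕ) :
    2 * ∑ k ∈ Finset.range n, (a (2 * k + 1) - a (2 * k + 2)) =
      a 1 - a (2 * n + 1) +
        ∑ k ∈ Finset.range n, (a (2 * k + 1) - 2 * a (2 * k + 2) + a (2 * k + 3)) := by
  induction n with
  | zero => simp
  | succ n ih =>
    rw [Finset.sum_range_succ, Finset.sum_range_succ, mul_add, ih]
    have e2 : 2 * (n + 1) + 1 = 2 * n + 3 := by ring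
    rw [e2]
    ring

variable {V : Type*} [AddCommGroup V] [Module ℝ V] {B : V →ₗ[ℝ] V →ₗ[ℝ] ℝ}
  {T : ℝ≥0 → V →ₗ[ℝ] V}

/-- Expand the square of `c • a - b`. The free weight `c` allows the two squares to be treated
unequally when limits are taken. -/
theorem two_mul_form_le (hsymm : ∀ a b, B a b = B b a) (hpos : ∀ a, 0 ≤ B a a) {c : ℝ}
    (hc : 0 < c) (a b : V) : 2 * B a b ≤ c * B a a + c⁻¹ * B b b := by
  have h := hpos (c • a - b)
  simp only [map_sub, map_smul, LinearMap.sub_apply, LinearMap.smul_apply, smul_eq_mul] at h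
  rw [hsymm b a] at h
  have h2 : 0 ≤ c⁻¹ * (c * (c * B a a - B a b) - (c * B a b - B b b)) := by positivity
  have h3 : c⁻¹ * (c * (c * B a a - B a b) - (c * B a b - B b b)) =
      c * B a a + c⁻¹ * B b b - 2 * B a b := by
    field_simp
    ring
  linarith

/-- The second difference is `T_{2s} (1 - T_t)²`, and self-adjointness moves one factor `T_s (1 -
T_t)` to each side. For `f = g` this is a square, whence convexity of `t ↦ B f (T t f)`. -/
theorem form_secondDiff (hT : ∀ s t a, T (s + t) a = T s (T t a))
    (hsa : ∀ t a b, B (T t a) b = B a (T t b)) (s t : ℝ≥0) (f g : V) :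
    B f (T (2 * s) g) - 2 * B f (T (2 * s + t) g) + B f (T (2 * s + 2 * t) g) =
      B (T s (f - T t f)) (T s (g - T t g)) := by
  rw [hsa, ← hT, ← two_mul, map_sub, LinearMap.sub_apply, hsa t, map_sub, ← hT, map_sub, map_sub,
    map_sub, ← hT, ← hT]
  rw [show t + 2 * s = 2 * s + t by ring, show t + (2 * s + t) = 2 * s + 2 * t by ring]
  ring

theorem form_self_secondDiff_nonneg (hpos : ∀ a, 0 ≤ B a a)
    (hT : ∀ s t a, T (s + t) a = T s (T t a))
    (hsa : ∀ t a b, B (T t a) b = B a (T t b)) (r t : ℝ≥0) (f : V) :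
    0 ≤ B f (T r f) - 2 * B f (T (r + t) f) + B f (T (r + 2 * t) f) := by
  have h := form_secondDiff hT hsa (r / 2) t f f
  rw [mul_div_cancel₀ _ (two_ne_zero)] at h
  rw [h]
  exact hpos _

/-- The mixed second differences are dominated termwise by the weighted pure ones, whose sums are
bounded by telescoping. -/
theorem two_mul_sum_form_le (hsymm : ∀ a b, B a b = B b a) (hpos : ∀ a, 0 ≤ B a a)
    (hT : ∀ s t a, T (s + t) a = T s (T t a))
    (hsa : ∀ t a b, B (T t a) b = B a (T t b)) {c : ℝ} (hc : 0 < c) (h : ℝ≥0) (f g : V) (n : ℕ) :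
    2 * ∑ k ∈ Finset.range n, (B f (T ((2 * k + 1 : ℕ) * h) g) - B f (T ((2 * k + 2 : ℕ) * h) g)) ≤
      B f (T h g) - B f (T ((2 * n + 1 : ℕ) * h) g) +
      (c * (B f (T h f) - B f (T (2 * h) f) +
        (B f (T ((2 * n + 2 : ℕ) * h) f) - B f (T ((2 * n + 1 : ℕ) * h) f))) +
      c⁻¹ * (B g (T h g) - B g (T (2 * h) g) +
        (B g (T ((2 * n + 2 : ℕ) * h) g) - B g (T ((2 * n + 1 : ℕ) * h) g)))) / 2 := by
  have key : ∀ q : V, ∑ k ∈ Finset.range n,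
      (B q (T ((2 * k + 1 : ℕ) * h) q) - 2 * B q (T ((2 * k + 2 : ℕ) * h) q) +
        B q (T ((2 * k + 3 : ℕ) * h) q)) ≤ B q (T h q) - B q (T (2 * h) q) +
        (B q (T ((2 * n + 2 : ℕ) * h) q) - B q (T ((2 * n + 1 : ℕ) * h) q)) := fun q => by
    have := sum_odd_secondDiff_le (a := fun j : ℕ => B q (T (j * h) q)) (fun j => ?_) n
    · simpa using this
    · have h1 := form_self_secondDiff_nonneg hpos hT hsa (j * h) h q
      rw [show ((j + 1 : ℕ) : ℝ≥0) * h = j * h + h by push_cast; ring,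
        show ((j + 2 : ℕ) : ℝ≥0) * h = j * h + 2 * h by push_cast; ring]
      exact h1
  have hmix : ∀ k : ℕ, B f (T ((2 * k + 1 : ℕ) * h) g) - 2 * B f (T ((2 * k + 2 : ℕ) * h) g) +
      B f (T ((2 * k + 3 : ℕ) * h) g) ≤
      (c * (B f (T ((2 * k + 1 : ℕ) * h) f) - 2 * B f (T ((2 * k + 2 : ℕ) * h) f) +
        B f (T ((2 * k + 3 : ℕ) * h) f)) +
      c⁻¹ * (B g (T ((2 * k + 1 : ℕ) * h) g) - 2 * B g (T ((2 * k + 2 : ℕ) * h) g) +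
        B g (T ((2 * k + 3 : ℕ) * h) g))) / 2 := fun k => by
    -- Halving the first time puts the three times in the form `2r`, `2r + h`, `2r + 2h`.
    obtain ⟨r, e0⟩ : ∃ r, ((2 * k + 1 : ℕ) : ℝ≥0) * h = 2 * r :=
      ⟨(2 * k + 1 : ℕ) * h / 2, by rw [mul_div_cancel₀ _ (two_ne_zero)]⟩
    have e1 : ((2 * k + 2 : ℕ) : ℝ≥0) * h = 2 * r + h := by
      rw [← e0]; push_cast; ring
    have e2 : ((2 * k + 3 : ℕ) : ℝ≥0) * h = 2 * r + 2 * h := by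
      rw [← e0]; push_cast; ring
    rw [e1, e2, e0, form_secondDiff hT hsa, form_secondDiff hT hsa, form_secondDiff hT hsa]
    have := two_mul_form_le hsymm hpos hc
      (T r (f - T h f)) (T r (g - T h g))
    linarith
  have htel := two_mul_sum_odd_diff (fun j : ℕ => B f (T (j * h) g)) n
  rw [htel]
  have hsum := Finset.sum_le_sum fun k (_ : k ∈ Finset.range n) => hmix k
  have hlin : ∀ u v : ℕ → ℝ, ∑ k ∈ Finset.range n, (c * u k + c⁻¹ * v k) / 2 =
      (c * ∑ k ∈ Finset.range n, u k + c⁻¹ * ∑ k ∈ Finset.range n, v k) / 2 := fun u v => by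
    rw [← Finset.sum_div, Finset.sum_add_distrib, ← Finset.mul_sum, ← Finset.mul_sum]
  rw [hlin] at hsum
  have h1 := mul_le_mul_of_nonneg_left (key f) hc.le
  have h2 := mul_le_mul_of_nonneg_left (key g) (inv_nonneg.2 hc.le)
  have e : ((1 : ℕ) : ℝ≥0) * h = h := by simp
  simp only [e]
  linarith

/-- Decrements of `t ↦ B f (T t f)` over intervals of length `t / n` ending at `t` are at most the
total decrement divided by `n`. -/
theorem nsmul_form_self_diff_le (hpos : ∀ a, 0 ≤ B a a)
    (hT : ∀ s t a, T (s + t) a = T s (T t a))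
    (hsa : ∀ t a b, B (T t a) b = B a (T t b)) (h : ℝ≥0) (f : V) (n : ℕ) :
    n * (B f (T (n * h) f) - B f (T ((n + 1 : ℕ) * h) f)) ≤ B f (T 0 f) - B f (T (n * h) f) := by
  induction n with
  | zero => simp
  | succ n ih =>
    have h1 := form_self_secondDiff_nonneg hpos hT hsa (n * h) h f
    rw [show (n * h + h : ℝ≥0) = (n + 1 : ℕ) * h by push_cast; ring,
      show (n * h + 2 * h : ℝ≥0) = (n + 1 + 1 : ℕ) * h by push_cast; ring] at h1
    have h2 : (n : ℝ) * (B f (T ((n + 1 : ℕ) * h) f) - B f (T ((n + 1 + 1 : ℕ) * h) f)) ≤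
        n * (B f (T (n * h) f) - B f (T ((n + 1 : ℕ) * h) f)) :=
      mul_le_mul_of_nonneg_left (by linarith) n.cast_nonneg
    push_cast at *
    nlinarith

end SymmetricSemigroup

/-! ### Bounded functions vanishing at the cemetery, with the inner product of `L²(μ)`. -/

section KilledFunctions

variable (E : Type u) [TopologicalSpace E]

/-- Bounded Borel functions on `E ∪ {∂}` that vanish at the cemetery. -/
def killedFun : Submodule ℝ (OnePoint E → ℝ) where
  carrier := {F | Measurable F ∧ (∃ C, ∀ z, ‖F z‖ ≤ C) ∧ F OnePoint.infty = 0}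
  add_mem' := by
    rintro F G ⟨hF, ⟨C, hC⟩, hF0⟩ ⟨hG, ⟨D, hD⟩, hG0⟩
    refine ⟨hF.add hG, ⟨C + D, fun z => (norm_add_le _ _).trans (add_le_add (hC z) (hD z))⟩, ?_⟩
    simp [hF0, hG0]
  zero_mem' := ⟨measurable_const, ⟨0, by simp⟩, rfl⟩
  smul_mem' := by
    rintro c F ⟨hF, ⟨C, hC⟩, hF0⟩
    refine ⟨hF.const_smul c, ⟨‖c‖ * C, fun z => ?_⟩, by simp [hF0]⟩
    rw [Pi.smul_apply, norm_smul]
    exact mul_le_mul_of_nonneg_left (hC z) (norm_nonneg c)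

variable {E}

theorem integrable_killedFun_comp (F : killedFun E) {α : Type*} [MeasurableSpace α] {μ : Measure α}
    [IsFiniteMeasure μ] {f : α → OnePoint E} (hf : Measurable f) :
    Integrable (fun a => F.1 (f a)) μ := by
  obtain ⟨F, hF, ⟨C, hC⟩, -⟩ := F
  exact Integrable.of_bound (hF.comp hf).aestronglyMeasurable C (ae_of_all _ fun a => hC _)

theorem integrable_killedFun (F : killedFun E) {μ : Measure (OnePoint E)} [IsFiniteMeasure μ] :
    Integrable F.1 μ :=
  integrable_killedFun_comp F measurable_id

theorem integrable_killedFun_mul (F G : killedFun E) {μ : Measure (OnePoint E)}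
    [IsFiniteMeasure μ] : Integrable (fun z => F.1 z * G.1 z) μ := by
  obtain ⟨F, hF, ⟨C, hC⟩, -⟩ := F
  obtain ⟨G, hG, ⟨D, hD⟩, -⟩ := G
  refine Integrable.of_bound (hF.mul hG).aestronglyMeasurable (C * D) (ae_of_all _ fun z => ?_)
  rw [norm_mul]
  exact mul_le_mul (hC z) (hD z) (norm_nonneg _) ((norm_nonneg _).trans (hC z))

/-- The `L²(μ)` inner product on bounded killed functions. -/
noncomputable def killedForm (μ : Measure (OnePoint E)) [IsFiniteMeasure μ] :
    killedFun E →ₗ[ℝ] killedFun E →ₗ[ℝ] ℝ :=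
  LinearMap.mk₂ ℝ (fun F G => ∫ z, F.1 z * G.1 z ∂μ)
    (fun F F' G => by
      rw [← integral_add (integrable_killedFun_mul F G) (integrable_killedFun_mul F' G)]
      simp [add_mul])
    (fun c F G => by
      rw [smul_eq_mul, ← integral_const_mul]
      simp [mul_assoc])
    (fun F G G' => by
      rw [← integral_add (integrable_killedFun_mul F G) (integrable_killedFun_mul F G')]
      simp [mul_add])
    (fun c F G => by
      rw [smul_eq_mul, ← integral_const_mul]
      simp [mul_left_comm])

theorem killedForm_apply (μ : Measure (OnePoint E)) [IsFiniteMeasure μ] (F G : killedFun E) :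
    killedForm μ F G = ∫ z, F.1 z * G.1 z ∂μ := rfl

theorem killedForm_symm (μ : Measure (OnePoint E)) [IsFiniteMeasure μ] (F G : killedFun E) :
    killedForm μ F G = killedForm μ G F := by
  simp only [killedForm_apply, mul_comm]

theorem killedForm_self_nonneg (μ : Measure (OnePoint E)) [IsFiniteMeasure μ] (F : killedFun E) :
    0 ≤ killedForm μ F F :=
  integral_nonneg fun z => mul_self_nonneg (F.1 z)

end KilledFunctions

/-! ### The semigroup of the killed process and its self-adjointness. -/

namespace HuntProcess

variable {E : Type u} [TopologicalSpace E] {Ω : Type v} [MeasurableSpace Ω]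

/-- The law of `X t` on `E ∪ {∂}`, as a kernel in the starting point. -/
noncomputable def timeKernel (H : HuntProcess E Ω) (t : ℝ≥0) : Kernel (OnePoint E) (OnePoint E) :=
  H.P.map (H.X t)

instance (H : HuntProcess E Ω) (t : ℝ≥0) : IsMarkovKernel (H.timeKernel t) :=
  Kernel.IsMarkovKernel.map _ (H.measurable_X t)

theorem timeKernel_apply (H : HuntProcess E Ω) (t : ℝ≥0) (x : OnePoint E) :
    H.timeKernel t x = (H.P x).map (H.X t) :=
  Kernel.map_apply _ (H.measurable_X t) _

/-- Chapman–Kolmogorov is the strong Markov property at the constant stopping time `s`. -/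
theorem timeKernel_add (H : HuntProcess E Ω) (s t : ℝ≥0) :
    H.timeKernel (s + t) = H.timeKernel t ∘ₖ H.timeKernel s := by
  ext x B hB
  have h := H.strongMarkov (fun _ => (s : WithTop ℝ≥0)) (isStoppingTime_const _ s) x Set.univ
    MeasurableSet.univ t B hB
  simp only [WithTop.coe_ne_top, WithTop.untopD_coe, ne_eq, not_false_eq_true, Set.ofPred_true,
    Set.univ_inter, Measure.restrict_univ] at h
  rw [Kernel.comp_apply' _ _ _ hB, timeKernel_apply, timeKernel_apply,
    Measure.map_apply (H.measurable_X _) hB,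
    lintegral_map (Kernel.measurable_coe _ hB) (H.measurable_X s)]
  refine Eq.trans h (lintegral_congr fun ω => ?_)
  rw [timeKernel_apply, Measure.map_apply (H.measurable_X _) hB]
  rfl

theorem integral_timeKernel (H : HuntProcess E Ω) (t : ℝ≥0) (x : OnePoint E) (F : killedFun E) :
    ∫ z, F.1 z ∂(H.timeKernel t x) = ∫ ω, F.1 (H.X t ω) ∂(H.P x) := by
  rw [timeKernel_apply, integral_map (H.measurable_X t).aemeasurable F.2.1.aestronglyMeasurable]

theorem ae_X_eq_infty [T1Space (OnePoint E)] (H : HuntProcess E Ω) (t : ℝ≥0) :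
    ∀ᵐ ω ∂(H.P OnePoint.infty), H.X t ω = OnePoint.infty := by
  filter_upwards [H.normal OnePoint.infty] with ω hω
  exact H.absorbing ω 0 t zero_le hω

/-- The semigroup of the killed process on bounded Borel functions. -/
noncomputable def semigroup [T1Space (OnePoint E)] (H : HuntProcess E Ω) (t : ℝ≥0) :
    killedFun E →ₗ[ℝ] killedFun E where
  toFun F := ⟨fun x => ∫ z, F.1 z ∂(H.timeKernel t x), by
    refine ⟨(F.2.1.stronglyMeasurable.integral_kernel).measurable, ?_, ?_⟩
    · obtain ⟨F, hF, ⟨C, hC⟩, -⟩ := F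
      refine ⟨C, fun x => ?_⟩
      simpa using norm_integral_le_of_norm_le_const (μ := H.timeKernel t x) (ae_of_all _ hC)
    · refine (H.integral_timeKernel t _ F).trans ?_
      refine integral_eq_zero_of_ae ?_
      filter_upwards [H.ae_X_eq_infty t] with ω hω
      rw [hω]
      exact F.2.2.2⟩
  map_add' F G := by
    ext x
    exact integral_add (integrable_killedFun F) (integrable_killedFun G)
  map_smul' c F := by
    ext x
    exact integral_const_mul c _

theorem semigroup_apply [T1Space (OnePoint E)] (H : HuntProcess E Ω) (t : ℝ≥0) (F : killedFun E)
    (x : OnePoint E) : (H.semigroup t F).1 x = ∫ ω, F.1 (H.X t ω) ∂(H.P x) :=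
  H.integral_timeKernel t x F

theorem semigroup_add [T1Space (OnePoint E)] (H : HuntProcess E Ω) (s t : ℝ≥0) (F : killedFun E) :
    H.semigroup (s + t) F = H.semigroup s (H.semigroup t F) := by
  ext x
  change ∫ z, F.1 z ∂(H.timeKernel (s + t) x) =
    ∫ y, ∫ z, F.1 z ∂(H.timeKernel t y) ∂(H.timeKernel s x)
  rw [timeKernel_add]
  exact Kernel.integral_comp (integrable_killedFun F)

variable [MeasurableSpace E] [BorelSpace E]

theorem measurableEmbedding_coe : MeasurableEmbedding ((↑) : E → OnePoint E) :=
  OnePoint.isOpenEmbedding_coe.measurableEmbedding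

theorem map_coe_singleton_infty (m : Measure E) :
    m.map ((↑) : E → OnePoint E) {OnePoint.infty} = 0 := by
  rw [measurableEmbedding_coe.map_apply]
  have : ((↑) : E → OnePoint E) ⁻¹' {OnePoint.infty} = ∅ := by
    ext x; simp
  rw [this, measure_empty]

theorem ae_map_coe_ne_infty (m : Measure E) :
    ∀ᵐ z ∂(m.map ((↑) : E → OnePoint E)), z ≠ OnePoint.infty := by
  rw [ae_iff]
  simpa using map_coe_singleton_infty m

instance (m : Measure E) [IsFiniteMeasure m] :
    IsFiniteMeasure (m.map ((↑) : E → OnePoint E)) := Measure.isFiniteMeasure_map _ _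

theorem transitionOp_coe [T1Space (OnePoint E)] (H : HuntProcess E Ω) (t : ℝ≥0) (F : killedFun E)
    (x : E) : H.transitionOp t (fun y => F.1 y) x = (H.semigroup t F).1 x := by
  unfold transitionOp transition
  rw [← measurableEmbedding_coe.integral_map (g := F.1), measurableEmbedding_coe.map_comap,
    ← timeKernel_apply]
  change _ = ∫ z, F.1 z ∂(H.timeKernel t x)
  refine setIntegral_eq_integral_of_forall_compl_eq_zero fun z hz => ?_
  rw [OnePoint.notMem_range_coe_iff.1 hz]
  exact F.2.2.2

theorem IsSelfDual.semigroup [T1Space (OnePoint E)] {H : HuntProcess E Ω} {m : Measure E}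
    [IsFiniteMeasure m] (hm : H.IsSelfDual m) (t : ℝ≥0) (F G : killedFun E) :
    killedForm (m.map ((↑) : E → OnePoint E)) (H.semigroup t F) G =
      killedForm (m.map ((↑) : E → OnePoint E)) F (H.semigroup t G) := by
  have hmem : ∀ F : killedFun E, MemLp (fun y : E => F.1 y) 2 m := fun F => by
    obtain ⟨F, hF, ⟨C, hC⟩, -⟩ := F
    exact MemLp.of_bound (hF.comp measurableEmbedding_coe.measurable).aestronglyMeasurable C
      (ae_of_all _ fun y => hC y)
  have h := hm t (fun y => F.1 y) (fun y => G.1 y) (F.2.1.comp measurableEmbedding_coe.measurable)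
    (G.2.1.comp measurableEmbedding_coe.measurable) (hmem F) (hmem G)
  rw [killedForm_apply, killedForm_apply, measurableEmbedding_coe.integral_map,
    measurableEmbedding_coe.integral_map]
  simp only [transitionOp_coe] at h
  exact h.symm

/-- The cemetery is removed because the law of `X t` may charge it, whereas the image of `m` does
not. -/
theorem timeKernel_null [T1Space (OnePoint E)] {H : HuntProcess E Ω} {m : Measure E}
    (hac : ∀ (t : ℝ≥0) (x : E), 0 < t → H.transition t x ≪ m) {t : ℝ≥0} (ht : 0 < t) (x : E)
    {A : Set (OnePoint E)} (hA : m.map ((↑) : E → OnePoint E) A = 0) :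
    H.timeKernel t x (A \ {OnePoint.infty}) = 0 := by
  rw [measurableEmbedding_coe.map_apply] at hA
  have h := hac t x ht hA
  unfold transition at h
  rw [measurableEmbedding_coe.comap_apply, Set.image_preimage_eq_inter_range,
    ← timeKernel_apply] at h
  refine measure_mono_null ?_ h
  rintro z ⟨hz, hz'⟩
  refine ⟨hz, ?_⟩
  by_contra h'
  exact hz' (OnePoint.notMem_range_coe_iff.1 h')

end HuntProcess

/-- The indicator of `E` in `E ∪ {∂}`. -/
noncomputable def aliveFun (E : Type u) [TopologicalSpace E] [T1Space (OnePoint E)] :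
    killedFun E :=
  ⟨({OnePoint.infty}ᶜ : Set (OnePoint E)).indicator 1, by
    refine ⟨measurable_one.indicator (measurableSet_singleton _).compl, ⟨1, fun z => ?_⟩, by simp⟩
    exact (norm_indicator_le_norm_self _ _).trans (by simp)⟩

theorem aliveFun_mul {E : Type u} [TopologicalSpace E] [T1Space (OnePoint E)] (F : killedFun E)
    (z : OnePoint E) : (aliveFun E).1 z * F.1 z = F.1 z := by
  by_cases hz : z = OnePoint.infty
  · rw [hz, F.2.2.2, mul_zero]
  · simp [aliveFun, hz]

theorem integral_eq_form_alive {E : Type u} [TopologicalSpace E] [T1Space (OnePoint E)]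
    (μ : Measure (OnePoint E)) [IsFiniteMeasure μ] (F : killedFun E) :
    ∫ z, F.1 z ∂μ = killedForm μ (aliveFun E) F := by
  rw [killedForm_apply]
  simp only [aliveFun_mul]

theorem form_alive_nonneg {E : Type u} [TopologicalSpace E] [T1Space (OnePoint E)]
    (μ : Measure (OnePoint E)) [IsFiniteMeasure μ] (F : killedFun E)
    (hF : ∀ z, 0 ≤ F.1 z) : 0 ≤ killedForm μ (aliveFun E) F := by
  rw [← integral_eq_form_alive]
  exact integral_nonneg hF

namespace HuntProcess

variable {E : Type u} [TopologicalSpace E] {Ω : Type v} [MeasurableSpace Ω]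

section Alive

variable [T1Space (OnePoint E)]

theorem lt_lifetime_iff (H : HuntProcess E Ω) (ω : Ω) (t : ℝ≥0) :
    (t : ℝ≥0∞) < H.lifetime ω ↔ H.X t ω ≠ OnePoint.infty := by
  rw [← not_le, lifetime_le_iff]

theorem semigroup_alive (H : HuntProcess E Ω) (t : ℝ≥0) (z : OnePoint E) :
    (H.semigroup t (aliveFun E)).1 z = (H.P z).real {ω | (t : ℝ≥0∞) < H.lifetime ω} := by
  rw [semigroup_apply]
  simp only [H.lt_lifetime_iff]
  have hm : MeasurableSet {ω | H.X t ω ≠ OnePoint.infty} :=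
    H.measurable_X t (measurableSet_singleton _).compl
  rw [← integral_indicator_one hm]
  rfl

theorem semigroup_alive_sub (H : HuntProcess E Ω) {s t : ℝ≥0} (hst : s ≤ t) (z : OnePoint E) :
    (H.semigroup s (aliveFun E) - H.semigroup t (aliveFun E)).1 z =
      (H.P z).real {ω | (s : ℝ≥0∞) < H.lifetime ω ∧ H.lifetime ω ≤ t} := by
  have h : {ω | (s : ℝ≥0∞) < H.lifetime ω ∧ H.lifetime ω ≤ t} =
      {ω | (s : ℝ≥0∞) < H.lifetime ω} \ {ω | (t : ℝ≥0∞) < H.lifetime ω} := by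
    ext ω; simp
  rw [h, measureReal_sdiff]
  · rw [← semigroup_alive, ← semigroup_alive]
    rfl
  · exact fun ω (hω : (t : ℝ≥0∞) < _) => lt_of_le_of_lt (ENNReal.coe_le_coe.2 hst) hω
  · exact measurableSet_lt measurable_const H.measurable_lifetime

theorem lifetime_pos (H : HuntProcess E Ω) (x : E) : ∀ᵐ ω ∂(H.P x), 0 < H.lifetime ω := by
  filter_upwards [H.normal x] with ω hω
  have := H.lt_lifetime_iff ω 0
  rw [ENNReal.coe_zero] at this
  rw [this, hω]
  exact OnePoint.coe_ne_infty x

theorem lifetime_eq_zero (H : HuntProcess E Ω) :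
    ∀ᵐ ω ∂(H.P OnePoint.infty), H.lifetime ω = 0 := by
  filter_upwards [H.ae_X_eq_infty 0] with ω hω
  have := (H.lifetime_le_iff ω 0).2 hω
  simpa using this

end Alive

/-! ### The lifetime has no positive finite atoms. -/

section NoAtoms

variable [T1Space (OnePoint E)] [MeasurableSpace E] [BorelSpace E]
  {H : HuntProcess E Ω} {m : Measure E} [IsFiniteMeasure m]

/-- By convexity, the decrements of `⟨1, P_t 1⟩` over successive intervals decrease, so the mass of
deaths in the `(n+1)`-st interval is at most `1 / n` of a fixed total. -/
theorem IsSelfDual.nsmul_form_alive_diff_le (hm : H.IsSelfDual m) (h : ℝ≥0) (n : ℕ) :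
    n * (∫ z, (H.semigroup (n * h) (aliveFun E) - H.semigroup ((n + 1 : ℕ) * h) (aliveFun E)).1 z
      ∂(m.map ((↑) : E → OnePoint E))) ≤
      killedForm (m.map ((↑) : E → OnePoint E)) (aliveFun E) (H.semigroup 0 (aliveFun E)) := by
  rw [integral_eq_form_alive, map_sub]
  refine (nsmul_form_self_diff_le (killedForm_self_nonneg _) H.semigroup_add hm.semigroup h _ n).trans
    ?_
  refine sub_le_self _ (form_alive_nonneg _ _ fun z => ?_)
  rw [semigroup_alive]
  exact measureReal_nonneg

/-- Write the time as `s + s`. During the first half the particle acquires a law on `E` absolutely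
continuous with respect to `m`; from almost every such position, convexity excludes death exactly
`s` later. -/
theorem IsSelfDual.lifetime_ne (hm : H.IsSelfDual m)
    (hac : ∀ (t : ℝ≥0) (x : E), 0 < t → H.transition t x ≪ m) {t : ℝ≥0} (ht : 0 < t)
    (x : OnePoint E) : H.P x {ω | H.lifetime ω = t} = 0 := by
  induction x using OnePoint.rec with
  | infty =>
    refine measure_mono_null ?_ (ae_iff.1 H.lifetime_eq_zero)
    intro ω hω h0
    rw [Set.mem_ofPred_eq, h0] at hω
    exact ht.ne (by exact_mod_cast hω)
  | coe x =>
    have hs : 0 < t / 2 := half_pos ht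
    have hts : t = t / 2 + t / 2 := (add_halves t).symm
    generalize t / 2 = s at hs hts
    subst hts
    -- `(r n, s]` is the last of `n + 1` equal pieces of `(0, s]`; these intervals shrink to the
    -- point `s`.
    obtain ⟨r, hr⟩ : ∃ r : ℕ → ℝ≥0, ∀ n, r n = n * (s / (n + 1 : ℕ)) := ⟨_, fun _ => rfl⟩
    have hrs : ∀ n : ℕ, s = (n + 1 : ℕ) * (s / (n + 1 : ℕ)) := fun n => by
      rw [mul_div_cancel₀ _ (by positivity)]
    have hrlt : ∀ n, r n < s := fun n => by
      rw [hr]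
      conv_rhs => rw [hrs n]
      have : 0 < s / (n + 1 : ℕ) := by positivity
      gcongr
      simp
    have hrmono : Monotone r := by
      refine monotone_nat_of_le_succ fun n => ?_
      rw [hr, hr, mul_div_assoc', mul_div_assoc', div_le_div_iff₀ (by positivity) (by positivity)]
      push_cast
      have : ((n : ℝ≥0) + 1) * s * (n + 1) = n * s * (n + 1 + 1) + s := by ring
      rw [this]
      exact le_self_add
    obtain ⟨w, hw⟩ : ∃ w : ℕ → OnePoint E → ℝ≥0∞, ∀ n z, w n z =
        ENNReal.ofReal ((H.semigroup (r n) (aliveFun E) - H.semigroup s (aliveFun E)).1 z) :=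
      ⟨_, fun _ _ => rfl⟩
    have hnn : ∀ n z, 0 ≤ (H.semigroup (r n) (aliveFun E) - H.semigroup s (aliveFun E)).1 z :=
      fun n z => by
        rw [H.semigroup_alive_sub (hrlt n).le]
        exact measureReal_nonneg
    have hwm : ∀ n, Measurable (w n) := fun n => by
      rw [funext (hw n)]
      exact ENNReal.measurable_ofReal.comp
        (H.semigroup (r n) (aliveFun E) - H.semigroup s (aliveFun E)).2.1
    have hint : ∀ (μ : Measure (OnePoint E)) [IsFiniteMeasure μ] n, ∫⁻ z, w n z ∂μ =
        ENNReal.ofReal (∫ z, (H.semigroup (r n) (aliveFun E) - H.semigroup s (aliveFun E)).1 z ∂μ) :=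
      fun μ _ n => by
        rw [ofReal_integral_eq_lintegral_ofReal (integrable_killedFun _)
          (ae_of_all _ (hnn n))]
        simp only [hw]
    have hanti : Antitone w := by
      intro n k hnk z
      rw [hw, hw]
      refine ENNReal.ofReal_le_ofReal ?_
      rw [H.semigroup_alive_sub (hrlt n).le, H.semigroup_alive_sub (hrlt k).le]
      refine measureReal_mono fun ω hω => ⟨lt_of_le_of_lt ?_ hω.1, hω.2⟩
      exact_mod_cast hrmono hnk
    have h0 : ∫⁻ z, ⨅ n, w n z ∂(m.map ((↑) : E → OnePoint E)) = 0 := by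
      obtain ⟨C, hC⟩ : ∃ C, C = killedForm (m.map ((↑) : E → OnePoint E)) (aliveFun E)
        (H.semigroup 0 (aliveFun E)) := ⟨_, rfl⟩
      have hle : ∀ n : ℕ, ∫⁻ z, ⨅ n, w n z ∂(m.map ((↑) : E → OnePoint E)) ≤
          ENNReal.ofReal (C / (n + 1 : ℕ)) := fun n => by
        -- The index `n + 1` keeps the denominator in the `C / (n + 1)` bound positive.
        refine (lintegral_mono fun z => iInf_le _ (n + 1)).trans ?_
        rw [hint]
        refine ENNReal.ofReal_le_ofReal ?_
        rw [le_div_iff₀' (by positivity), hC]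
        have := hm.nsmul_form_alive_diff_le (s / (n + 1 + 1 : ℕ)) (n + 1)
        rw [← hrs (n + 1), ← hr] at this
        exact this
      have hlim : Tendsto (fun n : ℕ => ENNReal.ofReal (C / (n + 1 : ℕ))) atTop (𝓝 0) := by
        rw [← ENNReal.ofReal_zero]
        refine (ENNReal.continuous_ofReal.tendsto 0).comp ?_
        exact (tendsto_const_div_atTop_nhds_zero_nat C).comp (tendsto_add_atTop_nat 1)
      exact le_antisymm (ge_of_tendsto' hlim hle) zero_le
    have hinfty : ∀ n, w n OnePoint.infty = 0 := fun n => by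
      rw [hw, (Subtype.prop _ : _ ∈ killedFun E).2.2, ENNReal.ofReal_zero]
    have h1 : ∫⁻ z, ⨅ n, w n z ∂(H.timeKernel s x) = 0 := by
      rw [lintegral_eq_zero_iff (Measurable.iInf hwm)] at h0 ⊢
      refine measure_mono_null ?_ (timeKernel_null hac hs x h0)
      intro z hz
      refine ⟨hz, ?_⟩
      rintro rfl
      refine hz (le_antisymm ?_ zero_le)
      exact (iInf_le _ 0).trans (hinfty 0).le
    rw [lintegral_iInf hwm hanti (by rw [hint]; exact ENNReal.ofReal_ne_top)] at h1
    refine le_antisymm (le_trans ?_ h1.le) zero_le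
    refine le_iInf fun n => ?_
    rw [hint]
    -- By the semigroup property, the integral against the law at time `s` is the probability that
    -- `s + r n < ζ ≤ s + s`.
    change _ ≤ ENNReal.ofReal ((H.semigroup s
      (H.semigroup (r n) (aliveFun E) - H.semigroup s (aliveFun E))).1 x)
    rw [map_sub, ← semigroup_add, ← semigroup_add,
      H.semigroup_alive_sub (add_le_add_right (hrlt n).le s), ofReal_measureReal]
    refine measure_mono fun ω (hω : H.lifetime ω = _) => ⟨?_, hω.le⟩
    rw [hω]
    exact_mod_cast (add_lt_add_iff_left s).2 (hrlt n)

/-- Two independent particles do not die at the same finite time. -/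
theorem IsSelfDual.lifetime_ne_lifetime (hm : H.IsSelfDual m)
    (hac : ∀ (t : ℝ≥0) (x : E), 0 < t → H.transition t x ≪ m) (x : E) (y : OnePoint E) :
    ∀ᵐ p ∂((H.P (x : OnePoint E)).prod (H.P y)), H.lifetime p.1 = H.lifetime p.2 →
      H.lifetime p.1 = ⊤ := by
  have hL := H.measurable_lifetime
  have hmeas : MeasurableSet {p : Ω × Ω | H.lifetime p.1 = H.lifetime p.2 →
      H.lifetime p.1 = ⊤} := by
    have h1 : MeasurableSet {p : Ω × Ω | H.lifetime p.1 = H.lifetime p.2} :=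
      measurableSet_eq_fun (hL.comp measurable_fst) (hL.comp measurable_snd)
    have h2 : MeasurableSet {p : Ω × Ω | H.lifetime p.1 = ⊤} :=
      (hL.comp measurable_fst) (measurableSet_singleton ⊤)
    exact h1.imp h2
  rw [Measure.ae_prod_iff_ae_ae hmeas]
  -- Fubini: with the first path fixed, its lifetime is a fixed positive number, which is not an
  -- atom for the second.
  filter_upwards [H.lifetime_pos x] with ω hω
  by_cases ht : H.lifetime ω = ⊤
  · exact ae_of_all _ fun _ _ => ht
  · lift H.lifetime ω to ℝ≥0 using ht with t
    rw [ae_iff]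
    refine measure_mono_null ?_ (hm.lifetime_ne hac (t := t) (by exact_mod_cast hω) y)
    intro ω' hω'
    simp only [Set.mem_ofPred_eq, Classical.not_imp] at hω'
    exact hω'.1.symm

end NoAtoms

end HuntProcess

theorem killedForm_le {E : Type u} [TopologicalSpace E] (μ : Measure (OnePoint E))
    [IsFiniteMeasure μ] {F G : killedFun E} {C D : ℝ} (hC : ∀ z, ‖F.1 z‖ ≤ C)
    (hD : ∀ z, ‖G.1 z‖ ≤ D) : |killedForm μ F G| ≤ C * D * μ.real Set.univ := by
  rw [killedForm_apply, ← Real.norm_eq_abs]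
  refine norm_integral_le_of_norm_le_const (ae_of_all _ fun z => ?_)
  rw [norm_mul]
  exact mul_le_mul (hC z) (hD z) (norm_nonneg _) ((norm_nonneg _).trans (hC z))

/-! ### Pairs with a common starting point, and subinvariance for one surviving particle. -/

namespace HuntProcess

variable {E : Type u} [TopologicalSpace E] {Ω : Type v} [MeasurableSpace Ω]

/-- Two independent copies of the process with a common starting point. -/
noncomputable def pairKernel (H : HuntProcess E Ω) : Kernel (OnePoint E) (Ω × Ω) :=
  (H.P ∥ₖ H.P).comap (fun z => (z, z)) (measurable_id.prodMk measurable_id)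

instance (H : HuntProcess E Ω) : IsMarkovKernel H.pairKernel := by
  unfold pairKernel
  infer_instance

theorem pairKernel_apply (H : HuntProcess E Ω) (z : OnePoint E) :
    H.pairKernel z = (H.P z).prod (H.P z) := by
  rw [pairKernel, Kernel.comap_apply, Kernel.parallelComp_apply]

/-- Two independent copies of the process with a common random starting point. -/
noncomputable def pairLaw (H : HuntProcess E Ω) (μ : Measure (OnePoint E)) : Measure (Ω × Ω) :=
  μ.bind H.pairKernel

instance (H : HuntProcess E Ω) (μ : Measure (OnePoint E)) [IsFiniteMeasure μ] :
    IsFiniteMeasure (H.pairLaw μ) := by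
  unfold pairLaw
  infer_instance

theorem lintegral_pairLaw (H : HuntProcess E Ω) (μ : Measure (OnePoint E)) {f : Ω × Ω → ℝ≥0∞}
    (hf : Measurable f) : ∫⁻ p, f p ∂(H.pairLaw μ) = ∫⁻ z, ∫⁻ p, f p ∂(H.pairKernel z) ∂μ :=
  Measure.lintegral_bind (Kernel.aemeasurable _) hf.aemeasurable

theorem ae_pairLaw (H : HuntProcess E Ω) (μ : Measure (OnePoint E)) {s : Set (Ω × Ω)}
    (hs : MeasurableSet s) (h : ∀ᵐ z ∂μ, ∀ᵐ p ∂(H.pairKernel z), p ∈ s) :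
    ∀ᵐ p ∂(H.pairLaw μ), p ∈ s := by
  rw [ae_iff]
  change H.pairLaw μ sᶜ = 0
  rw [pairLaw, Measure.bind_apply hs.compl (Kernel.aemeasurable _),
    lintegral_eq_zero_iff (Kernel.measurable_coe _ hs.compl)]
  filter_upwards [h] with z hz
  exact hz

theorem map_swap_pairLaw (H : HuntProcess E Ω) (μ : Measure (OnePoint E)) :
    (H.pairLaw μ).map Prod.swap = H.pairLaw μ := by
  ext s hs
  rw [Measure.map_apply measurable_swap hs, pairLaw,
    Measure.bind_apply (measurable_swap hs) (Kernel.aemeasurable _),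
    Measure.bind_apply hs (Kernel.aemeasurable _)]
  refine lintegral_congr fun z => ?_
  rw [pairKernel_apply, ← Measure.map_apply measurable_swap hs, Measure.prod_swap]

section HalfInvariance

variable [T1Space (OnePoint E)]

theorem norm_semigroup_le (H : HuntProcess E Ω) (t : ℝ≥0) {F : killedFun E} {C : ℝ}
    (hC : ∀ z, ‖F.1 z‖ ≤ C) (z : OnePoint E) : ‖(H.semigroup t F).1 z‖ ≤ C := by
  rw [semigroup_apply]
  simpa using norm_integral_le_of_norm_le_const (μ := H.P z) (ae_of_all _ fun ω => hC (H.X t ω))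

theorem form_semigroup_alive_mono (H : HuntProcess E Ω) (μ : Measure (OnePoint E))
    [IsFiniteMeasure μ] {s t : ℝ≥0} (hst : s ≤ t) {F : killedFun E} (hF : ∀ z, 0 ≤ F.1 z) :
    killedForm μ F (H.semigroup t (aliveFun E)) ≤ killedForm μ F (H.semigroup s (aliveFun E)) := by
  rw [← sub_nonneg, ← map_sub]
  refine integral_nonneg fun z => mul_nonneg (hF z) ?_
  rw [H.semigroup_alive_sub hst]
  exact measureReal_nonneg

theorem form_semigroup_alive_nonneg (H : HuntProcess E Ω) (μ : Measure (OnePoint E))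
    [IsFiniteMeasure μ] (t : ℝ≥0) {F : killedFun E} (hF : ∀ z, 0 ≤ F.1 z) :
    0 ≤ killedForm μ F (H.semigroup t (aliveFun E)) := by
  refine integral_nonneg fun z => mul_nonneg (hF z) ?_
  rw [semigroup_alive]
  exact measureReal_nonneg

theorem form_semigroup_alive_le (H : HuntProcess E Ω) (μ : Measure (OnePoint E))
    [IsFiniteMeasure μ] (t : ℝ≥0) {F : killedFun E} (hF : ∀ z, 0 ≤ F.1 z) :
    killedForm μ F (H.semigroup t (aliveFun E)) ≤ ∫ z, F.1 z ∂μ := by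
  refine integral_mono (integrable_killedFun_mul _ _) (integrable_killedFun _) fun z => ?_
  refine mul_le_of_le_one_right (hF z) ?_
  rw [semigroup_alive]
  exact measureReal_le_one

/-- On the dyadic mesh, the times `h` and `2h` give consecutive terms of one bounded monotone
sequence, so the limit itself need not be identified. -/
theorem form_alive_semigroup_alive_dyadic (H : HuntProcess E Ω) (μ : Measure (OnePoint E))
    [IsFiniteMeasure μ] :
    Tendsto (fun N : ℕ => killedForm μ (aliveFun E) (H.semigroup ((1 / 2) ^ (N + 1)) (aliveFun E)) -
      killedForm μ (aliveFun E) (H.semigroup (2 * (1 / 2) ^ (N + 1)) (aliveFun E))) atTop (𝓝 0) := by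
  have h0 : ∀ z, 0 ≤ (aliveFun E).1 z := fun z =>
    Set.indicator_nonneg (fun _ _ => zero_le_one) z
  have hmono : Monotone fun N : ℕ =>
      killedForm μ (aliveFun E) (H.semigroup ((1 / 2) ^ N) (aliveFun E)) := fun N M hNM =>
    H.form_semigroup_alive_mono μ (pow_le_pow_of_le_one zero_le (by norm_num) hNM) h0
  have hb : BddAbove (Set.range fun N : ℕ =>
      killedForm μ (aliveFun E) (H.semigroup ((1 / 2) ^ N) (aliveFun E))) := by
    refine ⟨∫ z, (aliveFun E).1 z ∂μ, ?_⟩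
    rintro _ ⟨N, rfl⟩
    exact H.form_semigroup_alive_le μ _ h0
  have hlim := tendsto_atTop_ciSup hmono hb
  have := (hlim.comp (tendsto_add_atTop_nat 1)).sub hlim
  rw [sub_self] at this
  refine this.congr fun N => ?_
  have e : (2 : ℝ≥0) * (1 / 2) ^ (N + 1) = (1 / 2) ^ N := by
    rw [pow_succ]
    field_simp
  rw [e]
  rfl

variable [MeasurableSpace E] [BorelSpace E] {H : HuntProcess E Ω} {m : Measure E}
  [IsFiniteMeasure m]

/-- One particle dies in `(k h, (k + 1) h]` and the other one is observed at `(k + 1) h`. -/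
theorem IsSelfDual.lintegral_pairLaw_cell (hm : H.IsSelfDual m) (h : ℝ≥0) (k : ℕ)
    {G : killedFun E} (hG : ∀ z, 0 ≤ G.1 z) :
    ∫⁻ p, {ω | ((k * h : ℝ≥0) : ℝ≥0∞) < H.lifetime ω ∧
        H.lifetime ω ≤ (((k + 1 : ℕ) * h : ℝ≥0) : ℝ≥0∞)}.indicator 1 p.1 *
        ENNReal.ofReal (G.1 (H.X ((k + 1 : ℕ) * h) p.2))
        ∂(H.pairLaw (m.map ((↑) : E → OnePoint E))) =
      ENNReal.ofReal (killedForm (m.map ((↑) : E → OnePoint E)) G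
          (H.semigroup ((2 * k + 1 : ℕ) * h) (aliveFun E)) -
        killedForm (m.map ((↑) : E → OnePoint E)) G
          (H.semigroup ((2 * k + 2 : ℕ) * h) (aliveFun E))) := by
  have hL := H.measurable_lifetime
  have hle : (k * h : ℝ≥0) ≤ (k + 1 : ℕ) * h := by gcongr; simp
  have hms : MeasurableSet {ω | ((k * h : ℝ≥0) : ℝ≥0∞) < H.lifetime ω ∧
      H.lifetime ω ≤ (((k + 1 : ℕ) * h : ℝ≥0) : ℝ≥0∞)} :=
    (measurableSet_lt measurable_const hL).inter (measurableSet_le hL measurable_const)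
  have hmG : Measurable fun ω => ENNReal.ofReal (G.1 (H.X ((k + 1 : ℕ) * h) ω)) :=
    ENNReal.measurable_ofReal.comp (G.2.1.comp (H.measurable_X _))
  have hmi : Measurable ({ω | ((k * h : ℝ≥0) : ℝ≥0∞) < H.lifetime ω ∧
        H.lifetime ω ≤ (((k + 1 : ℕ) * h : ℝ≥0) : ℝ≥0∞)}.indicator (1 : Ω → ℝ≥0∞)) :=
    measurable_one.indicator hms
  refine (H.lintegral_pairLaw _ ((hmi.comp measurable_fst).mul (hmG.comp measurable_snd))).trans ?_
  have hz : ∀ z, ∫⁻ p, {ω | ((k * h : ℝ≥0) : ℝ≥0∞) < H.lifetime ω ∧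
        H.lifetime ω ≤ (((k + 1 : ℕ) * h : ℝ≥0) : ℝ≥0∞)}.indicator 1 p.1 *
        ENNReal.ofReal (G.1 (H.X ((k + 1 : ℕ) * h) p.2)) ∂(H.pairKernel z) =
      ENNReal.ofReal ((H.semigroup (k * h) (aliveFun E) -
        H.semigroup ((k + 1 : ℕ) * h) (aliveFun E)).1 z * (H.semigroup ((k + 1 : ℕ) * h) G).1 z) :=
    fun z => by
      rw [pairKernel_apply, lintegral_prod_mul hmi.aemeasurable hmG.aemeasurable,
        lintegral_indicator_one hms, ENNReal.ofReal_mul, H.semigroup_alive_sub hle,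
        ofReal_measureReal, semigroup_apply, ofReal_integral_eq_lintegral_ofReal
          (integrable_killedFun_comp _ (H.measurable_X _)) (ae_of_all _ fun ω => hG _)]
      rw [H.semigroup_alive_sub hle]
      exact measureReal_nonneg
  refine (lintegral_congr hz).trans ?_
  rw [← ofReal_integral_eq_lintegral_ofReal (integrable_killedFun_mul _ _)]
  -- Moving `P_{(k+1)h}` off `G` gives the times `kh + (k+1)h = (2k+1)h` and `2(k+1)h`.
  · rw [← killedForm_apply, ← hm.semigroup, killedForm_symm, map_sub, ← semigroup_add,
      ← semigroup_add, map_sub]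
    congr 5 <;> · push_cast; ring_nf
  · refine ae_of_all _ fun z => mul_nonneg ?_ ?_
    · rw [H.semigroup_alive_sub hle]
      exact measureReal_nonneg
    · rw [semigroup_apply]
      exact integral_nonneg fun ω => hG _

end HalfInvariance

end HuntProcess

namespace HuntProcess

variable {E : Type u} [TopologicalSpace E] {Ω : Type v} [MeasurableSpace Ω]
  [T1Space (OnePoint E)] [MeasurableSpace E] [BorelSpace E] {H : HuntProcess E Ω}
  {m : Measure E} [IsFiniteMeasure m]

/-- `two_mul_sum_form_le` for `G` and `1`. The error from `G` is bounded crudely, its four form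
values giving the factor `4`; the one from `1` is kept, since it tends to zero with `h`. -/
theorem IsSelfDual.tsum_cell_le (hm : H.IsSelfDual m) (h : ℝ≥0)
    {G : killedFun E} (hG : ∀ z, 0 ≤ G.1 z) {C : ℝ} (hC : ∀ z, ‖G.1 z‖ ≤ C) {c : ℝ} (hc : 0 < c) :
    ∑' k : ℕ, ENNReal.ofReal (killedForm (m.map ((↑) : E → OnePoint E)) G
          (H.semigroup ((2 * k + 1 : ℕ) * h) (aliveFun E)) -
        killedForm (m.map ((↑) : E → OnePoint E)) G
          (H.semigroup ((2 * k + 2 : ℕ) * h) (aliveFun E))) ≤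
      ENNReal.ofReal ((∫ z, G.1 z ∂(m.map ((↑) : E → OnePoint E)) +
        (c * (4 * (C * C * (m.map ((↑) : E → OnePoint E)).real Set.univ)) +
        c⁻¹ * (killedForm (m.map ((↑) : E → OnePoint E)) (aliveFun E)
            (H.semigroup h (aliveFun E)) -
          killedForm (m.map ((↑) : E → OnePoint E)) (aliveFun E)
            (H.semigroup (2 * h) (aliveFun E)))) / 2) / 2) := by
  refine ENNReal.tsum_le_of_sum_range_le fun n => ?_
  rw [← ENNReal.ofReal_sum_of_nonneg]
  · refine ENNReal.ofReal_le_ofReal ?_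
    rw [le_div_iff₀' two_pos]
    refine (two_mul_sum_form_le (killedForm_symm _) (killedForm_self_nonneg _) H.semigroup_add
      hm.semigroup hc h G (aliveFun E) n).trans ?_
    have hb : ∀ t, |killedForm (m.map ((↑) : E → OnePoint E)) G (H.semigroup t G)| ≤
        C * C * (m.map ((↑) : E → OnePoint E)).real Set.univ := fun t =>
      killedForm_le _ hC (H.norm_semigroup_le t hC)
    have h1 := abs_le.1 (hb h)
    have h2 := abs_le.1 (hb (2 * h))
    have h3 := abs_le.1 (hb ((2 * n + 2 : ℕ) * h))
    have h4 := abs_le.1 (hb ((2 * n + 1 : ℕ) * h))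
    have h5 := H.form_semigroup_alive_le (m.map ((↑) : E → OnePoint E)) h hG
    have h6 := H.form_semigroup_alive_nonneg (m.map ((↑) : E → OnePoint E))
      ((2 * n + 1 : ℕ) * h) hG
    have h7 := H.form_semigroup_alive_mono (m.map ((↑) : E → OnePoint E)) (F := aliveFun E)
      (s := (2 * n + 1 : ℕ) * h) (t := (2 * n + 2 : ℕ) * h) (by gcongr; simp)
      fun z => Set.indicator_nonneg (fun _ _ => zero_le_one) z
    gcongr ?_ + (c * ?_ + c⁻¹ * ?_) / 2 <;> linarith
  · intro k _
    exact sub_nonneg.2 (H.form_semigroup_alive_mono _ (by gcongr; simp) hG)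

/-- The subinvariance of `m`, for the event that a given particle of the pair survives and for test
functions that are continuous on `E`. -/
theorem IsSelfDual.lintegral_survivor_le_half (hm : H.IsSelfDual m)
    {G : killedFun E} (hG : ∀ z, 0 ≤ G.1 z) (hcont : ∀ z ≠ OnePoint.infty, ContinuousAt G.1 z) :
    ∫⁻ p in {p | H.lifetime p.1 < H.lifetime p.2},
        ENNReal.ofReal (G.1 (H.X (H.lifetime p.1).toNNReal p.2))
        ∂(H.pairLaw (m.map ((↑) : E → OnePoint E))) ≤
      ENNReal.ofReal ((∫ z, G.1 z ∂(m.map ((↑) : E → OnePoint E))) / 2) := by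
  have hL := H.measurable_lifetime
  have hset : MeasurableSet {p : Ω × Ω | H.lifetime p.1 < H.lifetime p.2} :=
    measurableSet_lt (hL.comp measurable_fst) (hL.comp measurable_snd)
  obtain ⟨f, hf⟩ : ∃ f : ℝ≥0 → ℕ → Ω × Ω → ℝ≥0∞, ∀ h k p, f h k p =
      {ω | ((k * h : ℝ≥0) : ℝ≥0∞) < H.lifetime ω ∧
        H.lifetime ω ≤ (((k + 1 : ℕ) * h : ℝ≥0) : ℝ≥0∞)}.indicator 1 p.1 *
        ENNReal.ofReal (G.1 (H.X ((k + 1 : ℕ) * h) p.2)) := ⟨_, fun _ _ _ => rfl⟩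
  have hfm : ∀ h k, Measurable (f h k) := fun h k => by
    rw [funext (hf h k)]
    have hms : MeasurableSet {ω | ((k * h : ℝ≥0) : ℝ≥0∞) < H.lifetime ω ∧
        H.lifetime ω ≤ (((k + 1 : ℕ) * h : ℝ≥0) : ℝ≥0∞)} :=
      (measurableSet_lt measurable_const hL).inter (measurableSet_le hL measurable_const)
    exact ((measurable_one.indicator hms).comp measurable_fst).mul
      ((ENNReal.measurable_ofReal.comp (G.2.1.comp (H.measurable_X _))).comp measurable_snd)
  have hpos : ∀ᵐ p ∂(H.pairLaw (m.map ((↑) : E → OnePoint E))), 0 < H.lifetime p.1 := by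
    refine H.ae_pairLaw _ (s := {p | 0 < H.lifetime p.1})
      (measurableSet_lt measurable_const (hL.comp measurable_fst)) ?_
    filter_upwards [ae_map_coe_ne_infty m] with z hz
    induction z using OnePoint.rec with
    | infty => exact absurd rfl hz
    | coe z =>
      rw [pairKernel_apply]
      exact Measure.quasiMeasurePreserving_fst.ae (H.lifetime_pos z)
  -- For a fixed pair of paths, it suffices to keep the cell containing the death time `t`. Its
  -- right endpoint `r N` tends to `t` from the right, and the survivor is not at `∂` at time `t`,
  -- so `G` is continuous there.
  have hfatou : ∀ᵐ p ∂(H.pairLaw (m.map ((↑) : E → OnePoint E))),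
      {p : Ω × Ω | H.lifetime p.1 < H.lifetime p.2}.indicator
        (fun p => ENNReal.ofReal (G.1 (H.X (H.lifetime p.1).toNNReal p.2))) p ≤
      liminf (fun N : ℕ => ∑' k, f ((1 / 2) ^ (N + 1)) k p) atTop := by
    filter_upwards [hpos] with p hp
    by_cases hlt : H.lifetime p.1 < H.lifetime p.2
    swap
    · rw [Set.indicator_of_notMem (by exact hlt)]
      exact zero_le
    rw [Set.indicator_of_mem (by exact hlt)]
    have hne := hlt.ne_top
    obtain ⟨t, ht⟩ : ∃ t : ℝ≥0, H.lifetime p.1 = t := ⟨_, (ENNReal.coe_toNNReal hne).symm⟩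
    rw [ht, ENNReal.toNNReal_coe]
    have htpos : 0 < t := by rw [ht] at hp; exact_mod_cast hp
    have hXne : H.X t p.2 ≠ OnePoint.infty := by
      rw [← H.lt_lifetime_iff, ← ht]
      exact hlt
    have hhpos : ∀ N : ℕ, (0 : ℝ≥0) < (1 / 2) ^ (N + 1) := fun N => by positivity
    obtain ⟨r, hr⟩ : ∃ r : ℕ → ℝ≥0, ∀ N, r N = (⌈t / (1 / 2) ^ (N + 1)⌉₊ : ℝ≥0) * (1 / 2) ^ (N + 1) :=
      ⟨_, fun _ => rfl⟩
    have hr1 : ∀ N, t ≤ r N := fun N => by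
      rw [hr, ← div_le_iff₀ (hhpos N)]
      exact Nat.le_ceil _
    have hr2 : ∀ N, r N ≤ t + (1 / 2) ^ (N + 1) := fun N => by
      rw [hr]
      calc (⌈t / (1 / 2) ^ (N + 1)⌉₊ : ℝ≥0) * (1 / 2) ^ (N + 1)
          ≤ (t / (1 / 2) ^ (N + 1) + 1) * (1 / 2) ^ (N + 1) := by
            gcongr
            exact (Nat.ceil_lt_add_one zero_le).le
        _ = t + (1 / 2) ^ (N + 1) := by
            rw [add_mul, one_mul, div_mul_cancel₀ _ (hhpos N).ne']
    have hrt : Tendsto r atTop (𝓝[Set.Ici t] t) := by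
      refine tendsto_nhdsWithin_iff.2 ⟨?_, Eventually.of_forall hr1⟩
      refine tendsto_of_tendsto_of_tendsto_of_le_of_le tendsto_const_nhds ?_ hr1 hr2
      have h0 : Tendsto (fun N : ℕ => ((1 / 2 : ℝ≥0)) ^ N) atTop (𝓝 0) :=
        tendsto_pow_atTop_nhds_zero_of_lt_one zero_le (by
          rw [div_lt_one two_pos]; exact one_lt_two)
      simpa using (tendsto_const_nhds (x := t)).add (h0.comp (tendsto_add_atTop_nat 1))
    have hlim : Tendsto (fun N => ENNReal.ofReal (G.1 (H.X (r N) p.2))) atTop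
        (𝓝 (ENNReal.ofReal (G.1 (H.X t p.2)))) :=
      (ENNReal.continuous_ofReal.tendsto _).comp
        ((hcont _ hXne).tendsto.comp ((H.rightContinuous p.2 t).tendsto.comp hrt))
    rw [← hlim.liminf_eq]
    refine liminf_le_liminf (Eventually.of_forall fun N => ?_)
    -- Positivity of `t` is needed here: cells are open on the left, so time `0` lies in none.
    obtain ⟨k, hk⟩ : ∃ k, ⌈t / (1 / 2 : ℝ≥0) ^ (N + 1)⌉₊ = k + 1 :=
      Nat.exists_eq_succ_of_ne_zero (Nat.ceil_pos.2 (div_pos htpos (hhpos N))).ne'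
    refine le_trans ?_ (ENNReal.le_tsum k)
    rw [hf, Set.indicator_of_mem, Pi.one_apply, one_mul, hr, hk]
    refine ⟨?_, ?_⟩
    · rw [ht, ENNReal.coe_lt_coe, ← lt_div_iff₀ (hhpos N)]
      exact Nat.lt_ceil.1 (hk ▸ k.lt_succ_self)
    · rw [ht, ENNReal.coe_le_coe, ← hk, ← hr]
      exact hr1 N
  obtain ⟨C, hC⟩ := G.2.2.1
  -- With `c` fixed, the mesh tends to zero and the term with `c⁻¹` disappears; only afterwards does
  -- `c` tend to zero.
  have hbound : ∀ c : ℝ, 0 < c → ∫⁻ p in {p | H.lifetime p.1 < H.lifetime p.2},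
        ENNReal.ofReal (G.1 (H.X (H.lifetime p.1).toNNReal p.2))
        ∂(H.pairLaw (m.map ((↑) : E → OnePoint E))) ≤
      ENNReal.ofReal ((∫ z, G.1 z ∂(m.map ((↑) : E → OnePoint E)) +
        (c * (4 * (C * C * (m.map ((↑) : E → OnePoint E)).real Set.univ)) + c⁻¹ * 0) / 2) / 2) :=
    fun c hc => by
      rw [← lintegral_indicator hset]
      refine (lintegral_mono_ae hfatou).trans ?_
      refine (lintegral_liminf_le fun N => Measurable.tsum fun k => hfm _ k).trans ?_
      have hlim : Tendsto (fun N : ℕ => ENNReal.ofReal ((∫ z, G.1 z ∂(m.map ((↑) : E → OnePoint E)) +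
        (c * (4 * (C * C * (m.map ((↑) : E → OnePoint E)).real Set.univ)) +
        c⁻¹ * (killedForm (m.map ((↑) : E → OnePoint E)) (aliveFun E)
            (H.semigroup ((1 / 2) ^ (N + 1)) (aliveFun E)) -
          killedForm (m.map ((↑) : E → OnePoint E)) (aliveFun E)
            (H.semigroup (2 * (1 / 2) ^ (N + 1)) (aliveFun E)))) / 2) / 2)) atTop
        (𝓝 (ENNReal.ofReal ((∫ z, G.1 z ∂(m.map ((↑) : E → OnePoint E)) +
        (c * (4 * (C * C * (m.map ((↑) : E → OnePoint E)).real Set.univ)) + c⁻¹ * 0) / 2) / 2))) := by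
        refine (ENNReal.continuous_ofReal.tendsto _).comp ?_
        exact ((tendsto_const_nhds.add ((tendsto_const_nhds.add
          ((H.form_alive_semigroup_alive_dyadic _).const_mul _)).div_const _)).div_const _)
      rw [← hlim.liminf_eq]
      refine liminf_le_liminf (Eventually.of_forall fun N => ?_)
      rw [lintegral_tsum fun k => (hfm _ k).aemeasurable]
      refine le_trans (le_of_eq (tsum_congr fun k => ?_)) (hm.tsum_cell_le _ hG hC hc)
      simp only [hf]
      exact hm.lintegral_pairLaw_cell _ k hG
  have hlim : Tendsto (fun c : ℝ => ENNReal.ofReal ((∫ z, G.1 z ∂(m.map ((↑) : E → OnePoint E)) +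
        (c * (4 * (C * C * (m.map ((↑) : E → OnePoint E)).real Set.univ)) + c⁻¹ * 0) / 2) / 2))
      (𝓝[>] 0) (𝓝 (ENNReal.ofReal ((∫ z, G.1 z ∂(m.map ((↑) : E → OnePoint E))) / 2))) := by
    refine (ENNReal.continuous_ofReal.tendsto _).comp ?_
    refine Tendsto.mono_left ?_ nhdsWithin_le_nhds
    have : Continuous fun c : ℝ => (∫ z, G.1 z ∂(m.map ((↑) : E → OnePoint E)) +
        (c * (4 * (C * C * (m.map ((↑) : E → OnePoint E)).real Set.univ)) + c⁻¹ * 0) / 2) / 2 := by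
      simp only [mul_zero]
      fun_prop
    simpa using this.tendsto 0
  exact ge_of_tendsto hlim (eventually_mem_nhdsWithin.mono hbound)

end HuntProcess

/-! ### Comparison of finite measures. -/

/-- Closed sets are approximated from outside by bounded continuous functions, and Borel sets from
inside by closed ones. -/
theorem measure_le_of_lintegral_continuous_le {S : Type*} [TopologicalSpace S]
    [TopologicalSpace.PseudoMetrizableSpace S] [MeasurableSpace S] [BorelSpace S]
    {μ ν : Measure S} [IsFiniteMeasure μ] [IsFiniteMeasure ν]
    (h : ∀ g : BoundedContinuousFunction S ℝ≥0, ∫⁻ z, g z ∂μ ≤ ∫⁻ z, g z ∂ν) : μ ≤ ν := by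
  have hF : ∀ F : Set S, IsClosed F → μ F ≤ ν F := fun F hF =>
    ge_of_tendsto' (HasOuterApproxClosed.tendsto_lintegral_apprSeq hF ν) fun n =>
      (HasOuterApproxClosed.measure_le_lintegral hF μ n).trans (h _)
  refine Measure.le_iff.2 fun s hs => ?_
  rw [hs.measure_eq_iSup_isClosed_of_ne_top (measure_ne_top μ s)]
  exact iSup₂_le fun F hFs => iSup_le fun hFc => (hF F hFc).trans (measure_mono hFs)

/-- Truncate the density at level `M`: the excess has integral at most `δ` for large `M`, uniformly
over all `k ≤ 1`. -/
theorem exists_lintegral_le_of_absolutelyContinuous {S : Type*} [MeasurableSpace S]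
    {μ ν : Measure S} [IsFiniteMeasure μ] [IsFiniteMeasure ν] (h : μ ≪ ν) {δ : ℝ≥0∞} (hδ : 0 < δ) :
    ∃ M : ℕ, ∀ k : S → ℝ≥0∞, Measurable k → (∀ z, k z ≤ 1) →
      ∫⁻ z, k z ∂μ ≤ M * ∫⁻ z, k z ∂ν + δ := by
  have hfm : Measurable (μ.rnDeriv ν) := Measure.measurable_rnDeriv μ ν
  have hlim : Tendsto (fun M : ℕ => ∫⁻ z, (μ.rnDeriv ν z - M) ∂ν) atTop (𝓝 (∫⁻ _, 0 ∂ν)) := by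
    refine tendsto_lintegral_of_dominated_convergence (μ.rnDeriv ν)
      (fun M => hfm.sub measurable_const) (fun M => ae_of_all _ fun z => tsub_le_self)
      (Measure.lintegral_rnDeriv_lt_top μ ν).ne ?_
    filter_upwards [Measure.rnDeriv_lt_top μ ν] with z hz
    obtain ⟨M, hM⟩ := ENNReal.exists_nat_gt hz.ne
    refine tendsto_const_nhds.congr' ?_
    filter_upwards [eventually_ge_atTop M] with n hn
    refine (tsub_eq_zero_of_le (hM.le.trans ?_)).symm
    exact_mod_cast hn
  rw [lintegral_zero] at hlim
  obtain ⟨M, hM⟩ := (hlim.eventually (ge_mem_nhds hδ)).exists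
  refine ⟨M, fun k hk hk1 => ?_⟩
  calc ∫⁻ z, k z ∂μ = ∫⁻ z, μ.rnDeriv ν z * k z ∂ν := by
        rw [lintegral_rnDeriv_mul h hk.aemeasurable]
    _ ≤ ∫⁻ z, (M * k z + (μ.rnDeriv ν z - M)) ∂ν := by
        refine lintegral_mono fun z => ?_
        calc μ.rnDeriv ν z * k z ≤ (M + (μ.rnDeriv ν z - M)) * k z := by
              gcongr
              exact le_add_tsub
          _ = M * k z + (μ.rnDeriv ν z - M) * k z := add_mul _ _ _
          _ ≤ M * k z + (μ.rnDeriv ν z - M) := by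
              gcongr
              exact mul_le_of_le_one_right zero_le (hk1 z)
    _ = M * ∫⁻ z, k z ∂ν + ∫⁻ z, (μ.rnDeriv ν z - M) ∂ν := by
        rw [lintegral_add_left (hk.const_mul _), lintegral_const_mul _ hk]
    _ ≤ M * ∫⁻ z, k z ∂ν + δ := by gcongr

/-! ### The position of the survivor: absolute continuity and subinvariance of `m`. -/

namespace HuntProcess

variable {E : Type u} [TopologicalSpace E] {Ω : Type v} [MeasurableSpace Ω]

theorem survivor_of_lt {H : HuntProcess E Ω} {p : Ω × Ω} (h : H.lifetime p.1 < H.lifetime p.2) :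
    H.survivor p = H.X (H.lifetime p.1).toNNReal p.2 := by
  rw [survivor, if_neg h.not_gt, if_pos h]

theorem survivor_of_gt {H : HuntProcess E Ω} {p : Ω × Ω} (h : H.lifetime p.2 < H.lifetime p.1) :
    H.survivor p = H.X (H.lifetime p.2).toNNReal p.1 := by
  rw [survivor, if_pos h]

section T1

variable [T1Space (OnePoint E)]

theorem measurable_firstDeath (H : HuntProcess E Ω) : Measurable H.firstDeath :=
  (H.measurable_lifetime.comp measurable_fst).min (H.measurable_lifetime.comp measurable_snd)

theorem measurableSet_firstDeath_lt_top (H : HuntProcess E Ω) :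
    MeasurableSet {p | H.firstDeath p < ⊤} :=
  measurableSet_lt H.measurable_firstDeath measurable_const

theorem X_ne_infty_of_lt {H : HuntProcess E Ω} {p : Ω × Ω}
    (h : H.lifetime p.1 < H.lifetime p.2) :
    H.X (H.lifetime p.1).toNNReal p.2 ≠ OnePoint.infty := by
  rw [← H.lt_lifetime_iff, ENNReal.coe_toNNReal h.ne_top]
  exact h

section WeakAssumptions

variable [MeasurableSpace E] [BorelSpace E]

theorem IsSelfDual.ae_pairLaw_lifetime {H : HuntProcess E Ω} {m : Measure E}
    [IsFiniteMeasure m] (hm : H.IsSelfDual m)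
    (hac : ∀ (t : ℝ≥0) (x : E), 0 < t → H.transition t x ≪ m) :
    ∀ᵐ p ∂(H.pairLaw (m.map ((↑) : E → OnePoint E))),
      H.lifetime p.1 = H.lifetime p.2 → H.lifetime p.1 = ⊤ := by
  have hL := H.measurable_lifetime
  have h1 : MeasurableSet {p : Ω × Ω | H.lifetime p.1 = H.lifetime p.2} :=
    measurableSet_eq_fun (hL.comp measurable_fst) (hL.comp measurable_snd)
  have h2 : MeasurableSet {p : Ω × Ω | H.lifetime p.1 = ⊤} :=
    (hL.comp measurable_fst) (measurableSet_singleton ⊤)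
  refine H.ae_pairLaw _ (h1.imp h2) ?_
  filter_upwards [ae_map_coe_ne_infty m] with z hz
  induction z using OnePoint.rec with
  | infty => exact absurd rfl hz
  | coe z =>
    rw [pairKernel_apply]
    exact hm.lifetime_ne_lifetime hac z z

/-- Given the first path, the second is observed at a fixed positive time, where its law on `E` is
absolutely continuous with respect to `m`; being alive then, it is not at `∂`. -/
theorem ae_notMem_of_lifetime_lt [TopologicalSpace.MetrizableSpace (OnePoint E)]
    {H : HuntProcess E Ω} {m : Measure E}
    (hac : ∀ (t : ℝ≥0) (x : E), 0 < t → H.transition t x ≪ m) (x y : E) {A : Set (OnePoint E)}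
    (hA : MeasurableSet A) (hA0 : m.map ((↑) : E → OnePoint E) A = 0) :
    ∀ᵐ p ∂((H.P (x : OnePoint E)).prod (H.P (y : OnePoint E))), H.lifetime p.1 < H.lifetime p.2 →
      H.X (H.lifetime p.1).toNNReal p.2 ∉ A := by
  have hL := H.measurable_lifetime
  have h1 : MeasurableSet {p : Ω × Ω | H.lifetime p.1 < H.lifetime p.2} :=
    measurableSet_lt (hL.comp measurable_fst) (hL.comp measurable_snd)
  have h2 : MeasurableSet {p : Ω × Ω | H.X (H.lifetime p.1).toNNReal p.2 ∉ A} :=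
    (H.measurable_uncurry_X.comp
      ((hL.comp measurable_fst).ennreal_toNNReal.prodMk measurable_snd)) hA.compl
  refine (Measure.ae_prod_iff_ae_ae (h1.imp h2)).2 ?_
  filter_upwards [H.lifetime_pos x] with ω hω
  by_cases ht : H.lifetime ω = ⊤
  · refine ae_of_all _ fun ω' h => ?_
    rw [ht] at h
    exact absurd h not_top_lt
  · have hpos : 0 < (H.lifetime ω).toNNReal := ENNReal.toNNReal_pos hω.ne' ht
    have hnull := timeKernel_null hac hpos y hA0
    rw [timeKernel_apply, Measure.map_apply (H.measurable_X _)
      (hA.diff (measurableSet_singleton _))] at hnull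
    filter_upwards [measure_eq_zero_iff_ae_notMem.1 hnull] with ω' hω' hlt hmem
    exact hω' ⟨hmem, X_ne_infty_of_lt (p := (ω, ω')) hlt⟩

end WeakAssumptions

end T1

variable [T2Space E] [LocallyCompactSpace E] [SecondCountableTopology E]

/-- The sub-probability law of the survivor's position, on the event that some particle dies. -/
noncomputable def survivorLaw (H : HuntProcess E Ω) (μ : Measure (Ω × Ω)) : Measure (OnePoint E) :=
  (μ.restrict {p | H.firstDeath p < ⊤}).map H.survivor

instance (H : HuntProcess E Ω) (μ : Measure (Ω × Ω)) [IsFiniteMeasure μ] :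
    IsFiniteMeasure (H.survivorLaw μ) := by
  unfold survivorLaw
  infer_instance

theorem lintegral_survivorLaw (H : HuntProcess E Ω) (μ : Measure (Ω × Ω)) {k : OnePoint E → ℝ≥0∞}
    (hk : Measurable k) : ∫⁻ z, k z ∂(H.survivorLaw μ) =
      ∫⁻ p, {p | H.firstDeath p < ⊤}.indicator (fun p => k (H.survivor p)) p ∂μ := by
  rw [survivorLaw, lintegral_map hk H.measurable_survivor,
    lintegral_indicator H.measurableSet_firstDeath_lt_top]

variable [MeasurableSpace E] [BorelSpace E] {H : HuntProcess E Ω} {m : Measure E}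
  [IsFiniteMeasure m]

/-- The measure `m` is subinvariant for the chain of survivors. -/
theorem IsSelfDual.survivorLaw_pairLaw_le (hm : H.IsSelfDual m)
    (hac : ∀ (t : ℝ≥0) (x : E), 0 < t → H.transition t x ≪ m) :
    H.survivorLaw (H.pairLaw (m.map ((↑) : E → OnePoint E))) ≤ m.map ((↑) : E → OnePoint E) := by
  have := metrizable_onePoint E
  have hL := H.measurable_lifetime
  refine measure_le_of_lintegral_continuous_le fun g => ?_
  have hgm : Measurable fun z => (g z : ℝ≥0∞) := g.continuous.measurable.coe_nnreal_ennreal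
  -- Setting `g` to zero at `∂` may destroy continuity only at `∂`, which a survivor avoids.
  obtain ⟨G, hGdef⟩ : ∃ G : killedFun E, G.1 =
      ({OnePoint.infty}ᶜ : Set (OnePoint E)).indicator (fun z => (g z : ℝ)) := by
    refine ⟨⟨_, (g.continuous.measurable.coe_nnreal_real).indicator
      (measurableSet_singleton _).compl, ⟨nndist g 0, fun z => ?_⟩, by simp⟩, rfl⟩
    refine (norm_indicator_le_norm_self _ _).trans ?_
    rw [Real.norm_of_nonneg (NNReal.coe_nonneg _)]
    exact_mod_cast BoundedContinuousFunction.NNReal.upper_bound g z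
  have hG0 : ∀ z, 0 ≤ G.1 z := fun z => by
    rw [hGdef]
    exact Set.indicator_nonneg (fun _ _ => NNReal.coe_nonneg _) z
  have hGg : ∀ z ≠ OnePoint.infty, ENNReal.ofReal (G.1 z) = g z := fun z hz => by
    rw [hGdef, Set.indicator_of_mem (by exact hz), ENNReal.ofReal_coe_nnreal]
  have hGc : ∀ z ≠ OnePoint.infty, ContinuousAt G.1 z := fun z hz => by
    have h1 : ContinuousAt (fun z => (g z : ℝ)) z :=
      (NNReal.continuous_coe.comp g.continuous).continuousAt
    refine h1.congr ?_
    filter_upwards [isOpen_compl_singleton.mem_nhds hz] with y hy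
    rw [hGdef, Set.indicator_of_mem hy]
  obtain ⟨q, hq⟩ : ∃ q : Ω × Ω → ℝ≥0∞, q = {p | H.lifetime p.1 < H.lifetime p.2}.indicator
      fun p => ENNReal.ofReal (G.1 (H.X (H.lifetime p.1).toNNReal p.2)) := ⟨_, rfl⟩
  have hset : MeasurableSet {p : Ω × Ω | H.lifetime p.1 < H.lifetime p.2} :=
    measurableSet_lt (hL.comp measurable_fst) (hL.comp measurable_snd)
  have hqm : Measurable q := by
    rw [hq]
    refine Measurable.indicator ?_ hset
    exact ENNReal.measurable_ofReal.comp (G.2.1.comp (H.measurable_uncurry_X.comp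
      ((hL.comp measurable_fst).ennreal_toNNReal.prodMk measurable_snd)))
  have hhalf : ∫⁻ p, q p ∂(H.pairLaw (m.map ((↑) : E → OnePoint E))) ≤
      ENNReal.ofReal ((∫ z, G.1 z ∂(m.map ((↑) : E → OnePoint E))) / 2) := by
    rw [hq, lintegral_indicator hset]
    exact hm.lintegral_survivor_le_half hG0 hGc
  have hswap : ∫⁻ p, q p.swap ∂(H.pairLaw (m.map ((↑) : E → OnePoint E))) =
      ∫⁻ p, q p ∂(H.pairLaw (m.map ((↑) : E → OnePoint E))) := by
    rw [← lintegral_map hqm measurable_swap, map_swap_pairLaw]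
  calc ∫⁻ z, g z ∂(H.survivorLaw (H.pairLaw (m.map ((↑) : E → OnePoint E))))
      ≤ ∫⁻ p, (q p + q p.swap) ∂(H.pairLaw (m.map ((↑) : E → OnePoint E))) := by
        rw [lintegral_survivorLaw _ _ hgm]
        refine lintegral_mono_ae ?_
        -- Without ties at finite times, exactly one particle survives; the two cases are exchanged
        -- by the swap and so have equal weight.
        filter_upwards [hm.ae_pairLaw_lifetime hac] with p hp
        by_cases hfin : H.firstDeath p < ⊤
        swap
        · rw [Set.indicator_of_notMem (by exact hfin)]
          exact zero_le
        rw [Set.indicator_of_mem (by exact hfin), hq]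
        rcases lt_trichotomy (H.lifetime p.1) (H.lifetime p.2) with h | h | h
        · refine le_add_right ?_
          rw [Set.indicator_of_mem (by exact h), survivor_of_lt h, hGg _ (X_ne_infty_of_lt h)]
        · rw [firstDeath, ← h, min_self, hp h] at hfin
          exact absurd hfin (lt_irrefl _)
        · refine le_add_left ?_
          rw [Set.indicator_of_mem (by exact h), survivor_of_gt h,
            hGg _ (X_ne_infty_of_lt (p := p.swap) h)]
          rfl
    _ ≤ ENNReal.ofReal ((∫ z, G.1 z ∂(m.map ((↑) : E → OnePoint E))) / 2) +
        ENNReal.ofReal ((∫ z, G.1 z ∂(m.map ((↑) : E → OnePoint E))) / 2) := by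
        rw [lintegral_add_left hqm, hswap]
        exact add_le_add hhalf hhalf
    _ = ∫⁻ z, ENNReal.ofReal (G.1 z) ∂(m.map ((↑) : E → OnePoint E)) := by
        have h0 : 0 ≤ ∫ z, G.1 z ∂(m.map ((↑) : E → OnePoint E)) := integral_nonneg hG0
        rw [← ENNReal.ofReal_add (by positivity) (by positivity), add_halves,
          ofReal_integral_eq_lintegral_ofReal (integrable_killedFun _) (ae_of_all _ hG0)]
    _ ≤ ∫⁻ z, g z ∂(m.map ((↑) : E → OnePoint E)) := by
        refine lintegral_mono_ae ?_
        filter_upwards [ae_map_coe_ne_infty m] with z hz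
        exact (hGg z hz).le

theorem IsSelfDual.survivorLaw_absolutelyContinuous (hm : H.IsSelfDual m)
    (hac : ∀ (t : ℝ≥0) (x : E), 0 < t → H.transition t x ≪ m) (x y : E) :
    H.survivorLaw ((H.P (x : OnePoint E)).prod (H.P (y : OnePoint E))) ≪
      m.map ((↑) : E → OnePoint E) := by
  have := metrizable_onePoint E
  refine Measure.AbsolutelyContinuous.mk fun A hA hA0 => ?_
  rw [survivorLaw, Measure.map_apply H.measurable_survivor hA,
    Measure.restrict_apply (H.measurable_survivor hA), measure_eq_zero_iff_ae_notMem]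
  -- The case in which the second particle dies first, obtained by exchanging the particles and
  -- their starting points.
  have hsw := ae_notMem_of_lifetime_lt hac y x hA hA0
  rw [← Measure.prod_swap] at hsw
  filter_upwards [hm.lifetime_ne_lifetime hac x y, ae_notMem_of_lifetime_lt hac x y hA hA0,
    ae_of_ae_map measurable_swap.aemeasurable hsw] with p h1 h2 h3
  rintro ⟨hp, hfin⟩
  rcases lt_trichotomy (H.lifetime p.1) (H.lifetime p.2) with h | h | h
  · rw [Set.mem_preimage, survivor_of_lt h] at hp
    exact h2 h hp
  · rw [Set.mem_ofPred_eq, firstDeath, ← h, min_self, h1 h] at hfin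
    exact absurd hfin (lt_irrefl _)
  · rw [Set.mem_preimage, survivor_of_gt h] at hp
    exact h3 h hp

end HuntProcess

/-! ### Marginals and one-step conditioning for trajectory measures. -/

theorem map_eval_zero_trajMeasure {X : ℕ → Type*} [∀ n, MeasurableSpace (X n)]
    (μ₀ : Measure (X 0)) (κ : (n : ℕ) → Kernel (Π i : Finset.Iic n, X i) (X (n + 1)))
    [∀ n, IsMarkovKernel (κ n)] :
    (Kernel.trajMeasure μ₀ κ).map (fun w => w 0) = μ₀ := by
  obtain ⟨φ, hφ⟩ : ∃ φ : (Π i : Finset.Iic 0, X i) → X 0,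
      φ = fun h => h ⟨0, Finset.mem_Iic.2 le_rfl⟩ := ⟨_, rfl⟩
  have hm : Measurable φ := by rw [hφ]; exact measurable_pi_apply _
  have h : (fun w : (Π n, X n) => w 0) = φ ∘ Preorder.frestrictLe 0 := by rw [hφ]; rfl
  have hs : φ ∘ (MeasurableEquiv.piUnique fun i : Finset.Iic 0 => X i).symm = id := by rw [hφ]; rfl
  rw [h, ← Measure.map_map hm (by fun_prop), Kernel.trajMeasure,
    Measure.map_comp _ _ (by fun_prop), Kernel.traj_map_frestrictLe, Kernel.partialTraj_self,
    Measure.id_comp]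
  refine (Measure.map_map hm (MeasurableEquiv.measurable _)).trans ?_
  exact (congrArg (fun f => Measure.map f μ₀) hs).trans Measure.map_id

theorem lintegral_trajMeasure_succ {X : ℕ → Type*} [∀ n, MeasurableSpace (X n)]
    (μ₀ : Measure (X 0)) [IsProbabilityMeasure μ₀]
    (κ : (n : ℕ) → Kernel (Π i : Finset.Iic n, X i) (X (n + 1)))
    [∀ n, IsMarkovKernel (κ n)] (n : ℕ) {f : (Π i : Finset.Iic n, X i) → ℝ≥0∞}
    {g : X (n + 1) → ℝ≥0∞} (hf : Measurable f) (hg : Measurable g) :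
    ∫⁻ w, f (Preorder.frestrictLe n w) * g (w (n + 1)) ∂(Kernel.trajMeasure μ₀ κ) =
      ∫⁻ w, f (Preorder.frestrictLe n w) * ∫⁻ q, g q ∂(κ n (Preorder.frestrictLe n w))
        ∂(Kernel.trajMeasure μ₀ κ) := by
  have hm : Measurable fun w : (Π n, X n) => (Preorder.frestrictLe n w, w (n + 1)) := by fun_prop
  have hfg : Measurable fun q : (Π i : Finset.Iic n, X i) × X (n + 1) => f q.1 * g q.2 := by fun_prop
  calc ∫⁻ w, f (Preorder.frestrictLe n w) * g (w (n + 1)) ∂(Kernel.trajMeasure μ₀ κ)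
      = ∫⁻ q, f q.1 * g q.2 ∂((Kernel.trajMeasure μ₀ κ).map
          fun w => (Preorder.frestrictLe n w, w (n + 1))) := (lintegral_map hfg hm).symm
    _ = ∫⁻ h, ∫⁻ q, f h * g q ∂(κ n h)
          ∂((Kernel.trajMeasure μ₀ κ).map (Preorder.frestrictLe n)) := by
        rw [← Kernel.map_frestrictLe_trajMeasure_compProd_eq_map_trajMeasure,
          Measure.lintegral_compProd hfg]
    _ = ∫⁻ h, f h * ∫⁻ q, g q ∂(κ n h)
          ∂((Kernel.trajMeasure μ₀ κ).map (Preorder.frestrictLe n)) :=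
        lintegral_congr fun h => lintegral_const_mul _ hg
    _ = _ :=
        lintegral_map (hf.mul hg.lintegral_kernel) (by fun_prop)

/-! ### Short excursions along the chain of survivors. -/

namespace HuntProcess

variable {E : Type u} [TopologicalSpace E] {Ω : Type v} [MeasurableSpace Ω]

/-- A series with finite sum has finite terms tending to zero. -/
theorem Extinct.exists_firstDeath_le {H : HuntProcess E Ω} {w : ℕ → Ω × Ω} (hw : H.Extinct w) {ε : ℝ≥0∞} (hε : 0 < ε) :
    ∃ N, (∀ j, H.firstDeath (w j) < ⊤) ∧ ∀ n, N ≤ n → H.firstDeath (w n) ≤ ε := by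
  have hsum : ∑' n, H.firstDeath (w n) ≠ ⊤ := by
    rw [ENNReal.tsum_eq_iSup_nat]
    exact LT.lt.ne hw
  obtain ⟨N, hN⟩ := eventually_atTop.1
    ((ENNReal.tendsto_atTop_zero_of_tsum_ne_top hsum).eventually (ge_mem_nhds hε))
  exact ⟨N, fun j => (ENNReal.ne_top_of_tsum_ne_top hsum j).lt_top, hN⟩

/-- The transition operator of the chain of survivors, killed when no particle ever dies. -/
noncomputable def survivorOp (H : HuntProcess E Ω) (k : OnePoint E → ℝ≥0∞) (z : OnePoint E) :
    ℝ≥0∞ :=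
  ∫⁻ p, {p | H.firstDeath p < ⊤}.indicator (fun p => k (H.survivor p)) p ∂(H.pairKernel z)

theorem survivorOp_le_one (H : HuntProcess E Ω) {k : OnePoint E → ℝ≥0∞} (hk : ∀ z, k z ≤ 1)
    (z : OnePoint E) : H.survivorOp k z ≤ 1 := by
  refine (lintegral_mono (g := fun _ => 1) fun p => ?_).trans (by simp)
  exact (Set.indicator_le_self _ _ _).trans (hk _)

/-- Both lifetimes are positive when the start lies in `E`, so the events decrease to a null set. -/
theorem tendsto_pairLaw_firstDeath_le [T1Space (OnePoint E)] [MeasurableSpace E] [BorelSpace E]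
    (H : HuntProcess E Ω) (m : Measure E) [IsFiniteMeasure m] :
    Tendsto (fun n : ℕ => H.pairLaw (m.map ((↑) : E → OnePoint E))
      {p | H.firstDeath p ≤ ((n : ℝ≥0∞) + 1)⁻¹}) atTop (𝓝 0) := by
  have hL := H.measurable_lifetime
  have hz : H.pairLaw (m.map ((↑) : E → OnePoint E))
      (⋂ n : ℕ, {p | H.firstDeath p ≤ ((n : ℝ≥0∞) + 1)⁻¹}) = 0 := by
    have hpos : ∀ᵐ p ∂(H.pairLaw (m.map ((↑) : E → OnePoint E))), p ∈ {p | 0 < H.firstDeath p} := by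
      refine H.ae_pairLaw _ (measurableSet_lt measurable_const H.measurable_firstDeath) ?_
      filter_upwards [ae_map_coe_ne_infty m] with z hz
      induction z using OnePoint.rec with
      | infty => exact absurd rfl hz
      | coe z =>
        rw [pairKernel_apply]
        filter_upwards [Measure.quasiMeasurePreserving_fst.ae (H.lifetime_pos z),
          Measure.quasiMeasurePreserving_snd.ae (H.lifetime_pos z)] with p h1 h2
        exact lt_min h1 h2
    refine measure_eq_zero_iff_ae_notMem.2 ?_
    filter_upwards [hpos] with p hp hmem
    rw [Set.mem_iInter] at hmem
    have hlim : Tendsto (fun n : ℕ => ((n : ℝ≥0∞) + 1)⁻¹) atTop (𝓝 0) := by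
      have := ENNReal.tendsto_inv_nat_nhds_zero.comp (tendsto_add_atTop_nat 1)
      refine this.congr fun n => ?_
      simp
    exact (ge_of_tendsto' hlim hmem).not_gt hp
  rw [← hz]
  refine tendsto_measure_iInter_atTop (fun n => ?_) (fun n k hnk p hp => ?_)
    ⟨0, measure_ne_top _ _⟩
  · exact (measurableSet_le H.measurable_firstDeath measurable_const).nullMeasurableSet
  · refine le_trans hp (ENNReal.inv_le_inv.2 ?_)
    gcongr

variable [T2Space E] [LocallyCompactSpace E] [SecondCountableTopology E]

theorem nextExcursion_apply (H : HuntProcess E Ω) (p : Ω × Ω) :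
    H.nextExcursion p = H.pairKernel (H.survivor p) := by
  rw [nextExcursion, Kernel.comap_apply, Kernel.parallelComp_apply, pairKernel_apply]

theorem measurable_survivorOp (H : HuntProcess E Ω) {k : OnePoint E → ℝ≥0∞} (hk : Measurable k) :
    Measurable (H.survivorOp k) :=
  ((hk.comp H.measurable_survivor).indicator H.measurableSet_firstDeath_lt_top).lintegral_kernel

/-- Markov property at a branching time, on the event that all earlier lifetimes are finite. -/
theorem lintegral_flemingViot_succ (H : HuntProcess E Ω) (x y : E) (n : ℕ) {g : Ω × Ω → ℝ≥0∞}
    (hg : Measurable g) :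
    ∫⁻ w, (∏ j ∈ Finset.range (n + 1), {p | H.firstDeath p < ⊤}.indicator 1 (w j)) * g (w (n + 1))
        ∂(H.flemingViot x y) =
      ∫⁻ w, (∏ j ∈ Finset.range n, {p | H.firstDeath p < ⊤}.indicator 1 (w j)) *
        {p | H.firstDeath p < ⊤}.indicator
          (fun p => ∫⁻ q, g q ∂(H.pairKernel (H.survivor p))) (w n) ∂(H.flemingViot x y) := by
  have hprod : ∀ w : ℕ → Ω × Ω,
      ∏ j ∈ Finset.range (n + 1), {p | H.firstDeath p < ⊤}.indicator (1 : Ω × Ω → ℝ≥0∞) (w j) =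
      ∏ j : Finset.Iic n, {p | H.firstDeath p < ⊤}.indicator 1 (Preorder.frestrictLe n w j) :=
    fun w => by
      rw [Nat.range_succ_eq_Iic]
      exact (Finset.prod_coe_sort (Finset.Iic n)
        fun j => {p | H.firstDeath p < ⊤}.indicator (1 : Ω × Ω → ℝ≥0∞) (w j)).symm
  have hi : Measurable ({p | H.firstDeath p < ⊤}.indicator (1 : Ω × Ω → ℝ≥0∞)) :=
    measurable_one.indicator H.measurableSet_firstDeath_lt_top
  have hf : Measurable fun h : (Finset.Iic n → Ω × Ω) =>
      ∏ j : Finset.Iic n, {p | H.firstDeath p < ⊤}.indicator (1 : Ω × Ω → ℝ≥0∞) (h j) :=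
    Finset.measurable_fun_prod _ fun j _ => hi.comp (measurable_pi_apply j)
  simp only [hprod]
  refine (lintegral_trajMeasure_succ (X := fun _ => Ω × Ω) _ _ n hf hg).trans ?_
  refine lintegral_congr fun w => ?_
  rw [← hprod, Finset.prod_range_succ, mul_assoc, Kernel.comap_apply, nextExcursion_apply]
  congr 1
  by_cases hw : w n ∈ {p | H.firstDeath p < ⊤}
  · rw [Set.indicator_of_mem hw, Set.indicator_of_mem hw]
    simp
  · rw [Set.indicator_of_notMem hw, Set.indicator_of_notMem hw, zero_mul]

/-- Induction through the Markov property at branching times. The indicators kill the chain at an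
infinite excursion, after which the encoding restarts from `∂`, a point that the image of `m` does
not charge. Nothing is lost, since extinction requires all excursions to be finite. -/
theorem lintegral_flemingViot_survivor (H : HuntProcess E Ω) (x y : E) (n : ℕ)
    {k : OnePoint E → ℝ≥0∞} (hk : Measurable k) :
    ∫⁻ w, (∏ j ∈ Finset.range n, {p | H.firstDeath p < ⊤}.indicator 1 (w j)) *
        {p | H.firstDeath p < ⊤}.indicator (fun p => k (H.survivor p)) (w n)
        ∂(H.flemingViot x y) =
      ∫⁻ z, (H.survivorOp)^[n] k z
        ∂(H.survivorLaw ((H.P (x : OnePoint E)).prod (H.P (y : OnePoint E)))) := by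
  induction n generalizing k with
  | zero =>
    have hm : Measurable ({p | H.firstDeath p < ⊤}.indicator (fun p => k (H.survivor p))) :=
      (hk.comp H.measurable_survivor).indicator H.measurableSet_firstDeath_lt_top
    simp only [Finset.range_zero, Finset.prod_empty, one_mul, Function.iterate_zero, id]
    rw [lintegral_survivorLaw _ _ hk]
    have h0 := map_eval_zero_trajMeasure (X := fun _ => Ω × Ω)
      ((H.P (x : OnePoint E)).prod (H.P (y : OnePoint E)))
      (fun n => H.nextExcursion.comap
        (fun h : (i : Finset.Iic n) → Ω × Ω => h ⟨n, Finset.mem_Iic.2 le_rfl⟩)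
        (measurable_pi_apply _))
    conv_rhs => rw [← h0]
    rw [lintegral_map hm (measurable_pi_apply 0)]
    rfl
  | succ n ih =>
    rw [Function.iterate_succ_apply, ← ih (H.measurable_survivorOp hk)]
    exact H.lintegral_flemingViot_succ x y n
      ((hk.comp H.measurable_survivor).indicator H.measurableSet_firstDeath_lt_top)

variable [MeasurableSpace E] [BorelSpace E] {H : HuntProcess E Ω} {m : Measure E}
  [IsFiniteMeasure m]

theorem IsSelfDual.lintegral_survivorOp_iterate_le (hm : H.IsSelfDual m)
    (hac : ∀ (t : ℝ≥0) (x : E), 0 < t → H.transition t x ≪ m) (n : ℕ) {k : OnePoint E → ℝ≥0∞}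
    (hk : Measurable k) :
    ∫⁻ z, (H.survivorOp)^[n] k z ∂(m.map ((↑) : E → OnePoint E)) ≤
      ∫⁻ z, k z ∂(m.map ((↑) : E → OnePoint E)) := by
  induction n generalizing k with
  | zero => simp
  | succ n ih =>
    rw [Function.iterate_succ_apply]
    refine (ih (H.measurable_survivorOp hk)).trans ?_
    refine (H.lintegral_pairLaw _ ((hk.comp H.measurable_survivor).indicator
      H.measurableSet_firstDeath_lt_top)).symm.trans_le ?_
    refine (H.lintegral_survivorLaw _ hk).symm.trans_le ?_
    exact lintegral_mono' (hm.survivorLaw_pairLaw_le hac) le_rfl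

/-- The probability that all excursions are finite and the one with index `n + 1` lasts at most `ε` is
bounded uniformly in `n`. -/
theorem IsSelfDual.exists_flemingViot_firstDeath_le (hm : H.IsSelfDual m)
    (hac : ∀ (t : ℝ≥0) (x : E), 0 < t → H.transition t x ≪ m) (x y : E) {δ : ℝ≥0∞} (hδ : 0 < δ) :
    ∃ M : ℕ, ∀ (ε : ℝ≥0∞) (n : ℕ), H.flemingViot x y
      {w | (∀ j, H.firstDeath (w j) < ⊤) ∧ H.firstDeath (w (n + 1)) ≤ ε} ≤
      M * H.pairLaw (m.map ((↑) : E → OnePoint E)) {p | H.firstDeath p ≤ ε} + δ := by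
  -- `M` depends only on the law of the first survivor and on `δ`, so it is fixed before `ε` and
  -- `n`.
  obtain ⟨M, hM⟩ := exists_lintegral_le_of_absolutelyContinuous
    (hm.survivorLaw_absolutelyContinuous hac x y) hδ
  refine ⟨M, fun ε n => ?_⟩
  have hset : MeasurableSet {p | H.firstDeath p ≤ ε} :=
    measurableSet_le H.measurable_firstDeath measurable_const
  have hg : Measurable ({p | H.firstDeath p ≤ ε}.indicator (1 : Ω × Ω → ℝ≥0∞)) :=
    measurable_one.indicator hset
  obtain ⟨k, hk⟩ : ∃ k : OnePoint E → ℝ≥0∞,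
      k = fun z => ∫⁻ q, {p | H.firstDeath p ≤ ε}.indicator 1 q ∂(H.pairKernel z) := ⟨_, rfl⟩
  have hkm : Measurable k := by
    rw [hk]
    exact hg.lintegral_kernel
  have hk1 : ∀ z, k z ≤ 1 := fun z => by
    simp only [hk, lintegral_indicator_one hset]
    exact prob_le_one
  have hit : ∀ n, Measurable ((H.survivorOp)^[n] k) ∧ ∀ z, (H.survivorOp)^[n] k z ≤ 1 := fun n => by
    induction n with
    | zero => exact ⟨hkm, hk1⟩
    | succ n ih =>
      rw [Function.iterate_succ_apply']
      exact ⟨H.measurable_survivorOp ih.1, H.survivorOp_le_one ih.2⟩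
  have hI : ∀ j, Measurable fun w : ℕ → Ω × Ω =>
      {p | H.firstDeath p < ⊤}.indicator (1 : Ω × Ω → ℝ≥0∞) (w j) := fun j =>
    (measurable_one.indicator H.measurableSet_firstDeath_lt_top).comp (measurable_pi_apply j)
  calc H.flemingViot x y {w | (∀ j, H.firstDeath (w j) < ⊤) ∧ H.firstDeath (w (n + 1)) ≤ ε}
      ≤ H.flemingViot x y {w | 1 ≤ (∏ j ∈ Finset.range (n + 1),
          {p | H.firstDeath p < ⊤}.indicator (1 : Ω × Ω → ℝ≥0∞) (w j)) *
          {p | H.firstDeath p ≤ ε}.indicator 1 (w (n + 1))} := by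
        refine measure_mono fun w hw => ?_
        have h1 : ∀ j, {p | H.firstDeath p < ⊤}.indicator (1 : Ω × Ω → ℝ≥0∞) (w j) = 1 := fun j => by
          rw [Set.indicator_of_mem (by exact hw.1 j), Pi.one_apply]
        rw [Set.mem_ofPred_eq, Set.indicator_of_mem (by exact hw.2)]
        simp [h1]
    _ ≤ ∫⁻ w, (∏ j ∈ Finset.range (n + 1),
          {p | H.firstDeath p < ⊤}.indicator (1 : Ω × Ω → ℝ≥0∞) (w j)) *
          {p | H.firstDeath p ≤ ε}.indicator 1 (w (n + 1)) ∂(H.flemingViot x y) := by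
        have := mul_meas_ge_le_lintegral (μ := H.flemingViot x y)
          ((Finset.measurable_fun_prod (Finset.range (n + 1)) fun j _ => hI j).mul
            (hg.comp (measurable_pi_apply (n + 1)))) 1
        rw [one_mul] at this
        exact this
    _ = ∫⁻ z, (H.survivorOp)^[n] k z
          ∂(H.survivorLaw ((H.P (x : OnePoint E)).prod (H.P (y : OnePoint E)))) := by
        rw [H.lintegral_flemingViot_succ x y n hg, ← H.lintegral_flemingViot_survivor x y n hkm, hk]
    -- The truncation estimate applies because the iterates stay bounded by `1`; subinvariance then
    -- removes them.
    _ ≤ M * ∫⁻ z, (H.survivorOp)^[n] k z ∂(m.map ((↑) : E → OnePoint E)) + δ :=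
        hM _ (hit n).1 (hit n).2
    _ ≤ M * ∫⁻ z, k z ∂(m.map ((↑) : E → OnePoint E)) + δ := by
        gcongr ?_ * ?_ + _
        · exact le_rfl
        · exact hm.lintegral_survivorOp_iterate_le hac n hkm
    _ = M * H.pairLaw (m.map ((↑) : E → OnePoint E)) {p | H.firstDeath p ≤ ε} + δ := by
        rw [← lintegral_indicator_one hset, lintegral_pairLaw _ _ hg, hk]

end HuntProcess

end FlemingViot

/-! ### Conclusion: extinction has probability zero. -/

theorem corollary1p2
    {E : Type*} [TopologicalSpace E] [T2Space E] [LocallyCompactSpace E]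
    [SecondCountableTopology E] [MeasurableSpace E] [BorelSpace E]
    {Ω : Type*} [MeasurableSpace Ω]
    (H : FlemingViot.HuntProcess E Ω) (m : Measure E) [IsFiniteMeasure m]
    (hdual : H.IsSelfDual m)
    (hac : ∀ (t : ℝ≥0) (x : E), 0 < t → H.transition t x ≪ m)
    (x y : E) :
    ∀ᵐ w ∂(H.flemingViot x y), ¬ H.Extinct w := by
  rw [ae_iff]
  simp only [not_not]
  refine le_antisymm (ENNReal.le_of_forall_pos_le_add fun δ hδ _ => ?_) zero_le
  rw [zero_add]
  obtain ⟨M, hM⟩ := hdual.exists_flemingViot_firstDeath_le hac x y (δ := δ) (by exact_mod_cast hδ)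
  have hlim := (ENNReal.Tendsto.const_mul (a := (M : ℝ≥0∞)) (H.tendsto_pairLaw_firstDeath_le m)
    (Or.inr (ENNReal.natCast_ne_top M))).add (tendsto_const_nhds (x := (δ : ℝ≥0∞)))
  rw [mul_zero, zero_add] at hlim
  -- Here `ε = 1 / (i + 1)` tends to zero with `M` and `δ` fixed.
  refine ge_of_tendsto' hlim fun i => ?_
  have hmono : Monotone fun N : ℕ => {w : ℕ → Ω × Ω | (∀ j, H.firstDeath (w j) < ⊤) ∧
      ∀ n, N ≤ n → H.firstDeath (w n) ≤ ((i : ℝ≥0∞) + 1)⁻¹} := fun N N' hN w hw =>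
    ⟨hw.1, fun n hn => hw.2 n (hN.trans hn)⟩
  calc H.flemingViot x y {w | H.Extinct w}
      ≤ H.flemingViot x y (⋃ N : ℕ, {w | (∀ j, H.firstDeath (w j) < ⊤) ∧
          ∀ n, N ≤ n → H.firstDeath (w n) ≤ ((i : ℝ≥0∞) + 1)⁻¹}) :=
        measure_mono fun w hw => Set.mem_iUnion.2
          (FlemingViot.HuntProcess.Extinct.exists_firstDeath_le hw (ENNReal.inv_pos.2 (by finiteness)))
    _ = ⨆ N : ℕ, H.flemingViot x y {w | (∀ j, H.firstDeath (w j) < ⊤) ∧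
          ∀ n, N ≤ n → H.firstDeath (w n) ≤ ((i : ℝ≥0∞) + 1)⁻¹} := hmono.measure_iUnion
    -- One short excursion beyond `N` suffices. The index `N + 1` is used because the uniform bound
    -- excludes the initial excursion, which does not start from a survivor.
    _ ≤ _ := iSup_le fun N => le_trans (measure_mono (by
        rintro w ⟨hw, hwN⟩
        exact ⟨hw, hwN (N + 1) N.le_succ⟩)) (hM _ N)
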